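/- Identify $\mathbb R^4$ with the quaternions $\mathbb H$, oriented by $(1,i,j,k)$. Let $B^4$ be the closed unit ball and $S^3=\partial B^4$ the unit quaternions, with the round metric and the boundary orientation (outward normal first). Let $\eta=(\eta_1,\eta_2,\eta_3)$ be the left-invariant coframe of $S^3$ given by the imaginary part of $-q^{-1}dq$, so that $d\eta_a=2\,\eta_b\wedge\eta_c$ for $(a,b,c)$ cyclic. It is extended to $\mathbb H\setminus\{0\}$ by pull-back along $x\mapsto x/|x|$. Identify triples of forms with forms valued in the imaginary quaternions. For a triple $\gamma$ of forms on $S^3$, $q\gamma q^{-1}$ denotes the triple whose value at $q\in S^3$ is $q\,\gamma|_q\,q^{-1}$; for triples on $\mathbb H\setminus\{0\}$ we use the same notation with $q=x/|x|$. Put $\gamma=(\eta_2\wedge\eta_3,\ \eta_3\wedge\eta_1,\ \eta_1\wedge\eta_2)$. Definitions. A closed framing is a triple of smooth closed 2-forms on $S^3$ that are pointwise linearly independent. A smooth 2-form on $S^3$ is negative frequency if it lies in the closed span of the smooth eigenforms of $d*$ on 2-forms with negative eigenvalue. A hyperkähler triple is a triple of smooth (up to the boundary) closed 2-forms with $\sum_c\omega_c^2>0$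 and $\omega_a\wedge\omega_b=\tfrac13\delta_{ab}\sum_c\omega_c^2$. A hyperkähler filling of a closed framing to $B^4$ is a hyperkähler triple on $B^4$ that restricts to the framing on $S^3$. For $m>0$, Taub–NUT with mass $m$ is $\mathbb R^4$ with radial coordinate $r=m+|x|^2\ge m$ and the hyperkähler triple which away from the origin is $q\,\omega\, q^{-1}$, with $\omega_a=f_a\,dt\wedge\eta_a+f_bf_c\,\eta_b\wedge\eta_c$ for $(a,b,c)$ cyclic, where $$f_1=2m\sqrt{\tfrac{r-m}{r+m}},\quad f_2=f_3=\sqrt{r^2-m^2},\quad dt=-\tfrac12\sqrt{\tfrac{r+m}{r-m}}\,dr .$$ **Proposition.** The triple $q\gamma q^{-1}$ is a closed framing of the 2-forms on $S^3$, and the metric for which it is orthonormal is the round one. Let $m>0$. The triple above extends smoothly over the origin to a hyperkähler triple on $\mathbb R^4$, whose metric away from the origin is $$\tfrac14\tfrac{r+m}{r-m}\,dr^2+4m^2\tfrac{r-m}{r+m}\,\eta_1^2+(r^2-m^2)(\eta_2^2+\eta_3^2).$$ Moreover there are $r_0>m$ and a triple $\hat\gamma=(c_1\,\eta_2\wedge\eta_3,\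 c_2\,\eta_3\wedge\eta_1,\ c_3\,\eta_1\wedge\eta_2)$ with constants $c_a\in\mathbb R$ such that 1. $q\hat\gamma q^{-1}$ is a closed framing of the 2-forms on $S^3$; 2. each component of $q(\hat\gamma-\gamma)q^{-1}$ is negative frequency with respect to $d*$ on $S^3$; 3. the ball $\{r\le r_0\}$ in Taub–NUT with mass $m$, identified with $B^4$ by the dilation $x\mapsto\sqrt{r_0-m}\,x$, is a hyperkähler filling of $q\hat\gamma q^{-1}$ to $B^4$. It is the only one of its $SU(2)$-invariant form: let $\omega'$ be a hyperkähler filling of $q\hat\gamma q^{-1}$ to $B^4$ which on $B^4\setminus\{0\}$ equals $q\,(f_aN\,d\rho\wedge\eta_a+f_bf_c\,\eta_b\wedge\eta_c)_a\,q^{-1}$ for functions $N,f_1,f_2,f_3$ of $\rho=|x|$ that are smooth on $(0,1]$. Then there is a continuous, strictly increasing $s:[0,1]\to\mathbb R$, smooth on $(0,1]$, with $s(0)=0$ and $s(1)=\sqrt{r_0-m}$, such that on the interior of $B^4$ minus the origin $\omega'$ is the pull-back of the Taub–NUT triple by $x\mapsto s(|x|)\,x/|x|$. -/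

import Mathlib

open scoped Quaternion ContDiff InnerProductSpace
open Metric Set

noncomputable section

namespace TaubNUTFilling

/-! ### Quaternionic notation, and wedge products -/

/-- The imaginary units `i`, `j`, `k`. Indices in `Fin 3` are cyclic: `a`, `a + 1`, `a + 2`. -/
def imUnit : Fin 3 → ℍ[ℝ] := ![⟨0, 1, 0, 0⟩, ⟨0, 0, 1, 0⟩, ⟨0, 0, 0, 1⟩]

/-- The wedge product of two covectors, `(u, v) ↦ α u * β v - α v * β u`. -/
def wedge {E : Type*} [NormedAddCommGroup E] [NormedSpace ℝ E] (α β : E →L[ℝ] ℝ) :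
    E [⋀^Fin 2]→L[ℝ] ℝ :=
  ContinuousMultilinearMap.alternatization
    ((ContinuousMultilinearMap.mkPiAlgebra ℝ (Fin 2) ℝ).compContinuousLinearMap ![α, β])

theorem wedge_apply {E : Type*} [NormedAddCommGroup E] [NormedSpace ℝ E] (α β : E →L[ℝ] ℝ)
    (u v : E) : wedge α β ![u, v] = α u * β v - α v * β u := by
  rw [wedge, ContinuousMultilinearMap.alternatization_apply_apply]
  have h : (Finset.univ : Finset (Equiv.Perm (Fin 2))) = {1, Equiv.swap 0 1} := by decide
  have h' : (1 : Equiv.Perm (Fin 2)) ≠ Equiv.swap 0 1 := by decide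
  rw [h, Finset.sum_pair h']
  simp [Fin.prod_univ_two, sub_eq_add_neg]

/-- The wedge product of two 2-covectors on `ℍ ≅ ℝ⁴`, as a multiple of the volume element of the
orientation `(1, i, j, k)`, that is, evaluated on `(1, i, j, k)`. -/
def wedgeTop (α β : ℍ[ℝ] [⋀^Fin 2]→L[ℝ] ℝ) : ℝ :=
  ∑ a : Fin 3,
    (α ![1, imUnit a] * β ![imUnit (a + 1), imUnit (a + 2)]
      + α ![imUnit (a + 1), imUnit (a + 2)] * β ![1, imUnit a])

/-- The matrix of the rotation `w ↦ x w x⁻¹` of the imaginary quaternions. -/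
def rot (x : ℍ[ℝ]) (a b : Fin 3) : ℝ := ⟪imUnit a, x * imUnit b * x⁻¹⟫_ℝ

/-- The left-invariant coframe `η` of `S³`, extended to `ℍ \ {0}` by pulling back along
`x ↦ x / ‖x‖`: the components of the imaginary part of `-x⁻¹ dx`. The sign is the one for which
`dη_a = 2 η_{a+1} ∧ η_{a+2}`. -/
def eta (a : Fin 3) (x : ℍ[ℝ]) : ℍ[ℝ] →L[ℝ] ℝ :=
  -((innerSL ℝ (imUnit a)).comp (ContinuousLinearMap.mul ℝ ℍ[ℝ] x⁻¹))

/-! ### Differential forms on the three-sphere -/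

/-- The unit sphere `S³` of the quaternions. -/
abbrev S3 : Type := sphere (0 : ℍ[ℝ]) 1

/-- The tangent space of `S³` at `q`. -/
abbrev Tan (q : S3) : Submodule ℝ ℍ[ℝ] := (ℝ ∙ (q : ℍ[ℝ]))ᗮ

/-- (Not necessarily continuous) differential forms of degree `k` on `S³`. -/
abbrev SphereForm (k : ℕ) : Type := ∀ q : S3, Tan q [⋀^Fin k]→L[ℝ] ℝ

/-- The point `x / ‖x‖` of `S³`. -/
def toSphere (x : ℍ[ℝ]) (hx : x ≠ 0) : S3 :=
  ⟨‖x‖⁻¹ • x, by simp [norm_smul, hx]⟩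

open Classical in
/-- The pull-back of a form on `S³` to `ℍ \ {0}` along the retraction `x ↦ x / ‖x‖`, whose
differential at `x` is `‖x‖⁻¹` times the orthogonal projection onto the tangent space. -/
def radialExt {k : ℕ} (α : SphereForm k) (x : ℍ[ℝ]) : ℍ[ℝ] [⋀^Fin k]→L[ℝ] ℝ :=
  if hx : x ≠ 0 then
    (α (toSphere x hx)).compContinuousLinearMap
      (‖x‖⁻¹ • (Tan (toSphere x hx)).orthogonalProjectionOnto)
  else 0

/-- The restriction (pull-back) to `S³` of a form on `ℍ`. -/
def restrictSphere {k : ℕ} (τ : ℍ[ℝ] → ℍ[ℝ] [⋀^Fin k]→L[ℝ] ℝ) : SphereForm k :=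
  fun q => (τ q).compContinuousLinearMap (Tan q).subtypeL

/-- Smoothness of a form on `S³`. -/
def IsSmoothForm {k : ℕ} (α : SphereForm k) : Prop :=
  ContDiffOn ℝ ∞ (radialExt α) {0}ᶜ

/-- The exterior derivative on `S³`. -/
def dS {k : ℕ} (α : SphereForm k) : SphereForm (k + 1) :=
  restrictSphere (extDeriv (radialExt α))

theorem mul_imUnit_mem (q : S3) (a : Fin 3) : (q : ℍ[ℝ]) * imUnit a ∈ Tan q := by
  rw [Submodule.mem_orthogonal_singleton_iff_inner_right, Quaternion.inner_def]
  have h : (imUnit a).re = 0 := by fin_cases a <;> rfl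
  simp only [Quaternion.re_mul, Quaternion.re_star, Quaternion.imI_star, Quaternion.imJ_star,
    Quaternion.imK_star, Quaternion.imI_mul, Quaternion.imJ_mul, Quaternion.imK_mul, h]
  ring

/-- The frame `(q i, q j, q k)` of `S³`. It is orthonormal for the round metric and positive for
the orientation of `S³` as the boundary of the unit ball of `ℍ` (outward normal first), the
orientation of `ℍ` being that of `(1, i, j, k)`. -/
def frame (q : S3) (a : Fin 3) : Tan q := ⟨(q : ℍ[ℝ]) * imUnit a, mul_imUnit_mem q a⟩

/-- The Hodge star of the round metric from 2-forms to 1-forms on `S³`, oriented as the boundary of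
the unit ball: it sends `e^{a+1} ∧ e^{a+2}` to `e^a`, `e` being the coframe dual to `frame`. -/
def star2 (α : SphereForm 2) : SphereForm 1 := fun q =>
  ContinuousAlternatingMap.ofSubsingleton ℝ (Tan q) ℝ (0 : Fin 1)
    (∑ a : Fin 3, α q ![frame q (a + 1), frame q (a + 2)] • innerSL ℝ (frame q a))

/-- The smooth 2-forms `α` on `S³` with `d * α = μ α`. -/
def eigenforms (μ : ℝ) : Set (SphereForm 2) :=
  {α | IsSmoothForm α ∧ dS (star2 α) = μ • α}

/-- A smooth 2-form on `S³` is of negative frequency with respect to `d *` if it lies in the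
closed span of the eigenforms of `d *` with negative eigenvalue. The closure is uniform; on smooth
forms every Sobolev norm gives the same condition. -/
def IsNegativeFrequency (α : SphereForm 2) : Prop :=
  IsSmoothForm α ∧ ∀ ε > 0, ∃ β ∈ Submodule.span ℝ (⋃ μ < (0 : ℝ), eigenforms μ),
    ∀ (q : S3) (a : Fin 3), |(α - β) q ![frame q (a + 1), frame q (a + 2)]| < ε

/-- A closed framing of the (rank 3) bundle of 2-forms on `S³`. -/
structure IsClosedFraming (γ : Fin 3 → SphereForm 2) : Prop where
  smooth : ∀ a, IsSmoothForm (γ a)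
  closed : ∀ a, dS (γ a) = 0
  framing : ∀ q, LinearIndependent ℝ (fun a => γ a q)

/-- The metric on `S³` determined by the framing `γ` (the one for which `γ` is orthonormal) is the
round metric. -/
def InducesRoundMetric (γ : Fin 3 → SphereForm 2) : Prop :=
  ∀ (q : S3) (a b : Fin 3),
    ∑ c : Fin 3, γ a q ![frame q (c + 1), frame q (c + 2)]
      * γ b q ![frame q (c + 1), frame q (c + 2)] = if a = b then 1 else 0

/-- The triple `(c₁ η₂ ∧ η₃, c₂ η₃ ∧ η₁, c₃ η₁ ∧ η₂)`. -/
def leftInvariantTriple (c : Fin 3 → ℝ) : Fin 3 → SphereForm 2 := fun a =>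
  restrictSphere (fun x => c a • wedge (eta (a + 1) x) (eta (a + 2) x))

/-- The triple `γ = (η₂ ∧ η₃, η₃ ∧ η₁, η₁ ∧ η₂)`. -/
def stdTriple : Fin 3 → SphereForm 2 := leftInvariantTriple 1

/-- The triple given at `q` by `q γ q⁻¹`, triples being identified with 2-forms valued in the
imaginary quaternions. -/
def conjTriple (γ : Fin 3 → SphereForm 2) : Fin 3 → SphereForm 2 := fun a q =>
  ∑ b : Fin 3, rot q a b • γ b q

/-! ### Hyperkähler triples on subsets of `ℍ ≅ ℝ⁴` -/

/-- Differential 2-forms on `ℍ ≅ ℝ⁴`. -/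
abbrev TwoForm : Type := ℍ[ℝ] → ℍ[ℝ] [⋀^Fin 2]→L[ℝ] ℝ

/-- `τ` is a hyperkähler triple on `s` (smooth up to the boundary of `s`). -/
structure IsHyperkahlerTriple (τ : Fin 3 → TwoForm) (s : Set ℍ[ℝ]) : Prop where
  smooth : ∀ a, ContDiffOn ℝ ∞ (τ a) s
  closed : ∀ a, ∀ x ∈ s, extDerivWithin (τ a) s x = 0
  pos : ∀ x ∈ s, 0 < ∑ c, wedgeTop (τ c x) (τ c x)
  orthogonal : ∀ x ∈ s, ∀ a b, wedgeTop (τ a x) (τ b x)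
    = if a = b then (1 / 3) * ∑ c, wedgeTop (τ c x) (τ c x) else 0

/-- At a point, the metric of a hyperkähler triple `τ` is `g`: there is a `g`-orthonormal coframe
`e⁰, …, e³` with `τ_a = e⁰ ∧ e^a + e^b ∧ e^c` for `(a, b, c)` cyclic. -/
def InducesMetric (τ : Fin 3 → ℍ[ℝ] [⋀^Fin 2]→L[ℝ] ℝ) (g : ℍ[ℝ] → ℍ[ℝ] → ℝ) : Prop :=
  ∃ e : Module.Basis (Fin 4) ℝ ℍ[ℝ],
    (∀ u v, g u v = ∑ i, e.coord i u * e.coord i v) ∧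
    ∀ (a : Fin 3) (u v : ℍ[ℝ]), τ a ![u, v] =
      (e.coord 0 u * e.coord a.succ v - e.coord 0 v * e.coord a.succ u)
      + (e.coord (a + 1).succ u * e.coord (a + 2).succ v
          - e.coord (a + 1).succ v * e.coord (a + 2).succ u)

/-- The hyperkähler triple `τ` on the closed unit ball `B⁴` fills the framing `γ` of `S³`. -/
def IsFilling (τ : Fin 3 → TwoForm) (γ : Fin 3 → SphereForm 2) : Prop :=
  IsHyperkahlerTriple τ (closedBall 0 1) ∧ ∀ a, restrictSphere (τ a) = γ a

/-- The pull-back of a 2-form. -/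
def pullback (Φ : ℍ[ℝ] → ℍ[ℝ]) (τ : TwoForm) : TwoForm := fun x =>
  (τ (Φ x)).compContinuousLinearMap (fderiv ℝ Φ x)

/-- The triple `q τ q⁻¹` on `ℍ \ {0}`, where `τ_a = f_a dt ∧ η_a + f_b f_c η_b ∧ η_c` for
`(a, b, c)` cyclic. The functions `f_a` depend on `ρ = ‖x‖` only, and `dt = N(ρ) dρ`. -/
def rotatingTriple (N : ℝ → ℝ) (f : Fin 3 → ℝ → ℝ) : Fin 3 → TwoForm := fun a x =>
  ∑ b : Fin 3, rot x a b •
    ((f b ‖x‖ * N ‖x‖) • wedge (innerSL ℝ (‖x‖⁻¹ • x)) (eta b x)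
      + (f (b + 1) ‖x‖ * f (b + 2) ‖x‖) • wedge (eta (b + 1) x) (eta (b + 2) x))

/-! ### Taub–NUT -/

/-- The radial coordinate `r ≥ m` of Taub–NUT space as a function of `ρ = ‖x‖`. -/
def tnRadius (m ρ : ℝ) : ℝ := m + ρ ^ 2

/-- The functions `f₁ = 2 m (r - m)^{1/2} (r + m)^{-1/2}` and `f₂ = f₃ = (r² - m²)^{1/2}`. -/
def tnProfile (m : ℝ) : Fin 3 → ℝ → ℝ :=
  ![fun ρ => 2 * m * √((tnRadius m ρ - m) / (tnRadius m ρ + m)),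
    fun ρ => √(tnRadius m ρ ^ 2 - m ^ 2),
    fun ρ => √(tnRadius m ρ ^ 2 - m ^ 2)]

/-- The function `N` with `dt = -(1/2) ((r + m) / (r - m))^{1/2} dr = N(ρ) dρ`; here
`dr = 2 ρ dρ`. -/
def tnLapse (m ρ : ℝ) : ℝ :=
  -(1 / 2) * √((tnRadius m ρ + m) / (tnRadius m ρ - m)) * (2 * ρ)

/-- The Taub–NUT metric of mass `m`,
`(1/4) (r + m)/(r - m) dr² + 4 m² (r - m)/(r + m) η₁² + (r² - m²) (η₂² + η₃²)`. -/
def tnMetric (m : ℝ) (x u v : ℍ[ℝ]) : ℝ :=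
  let r := tnRadius m ‖x‖
  1 / 4 * ((r + m) / (r - m)) * ((2 * ⟪x, u⟫_ℝ) * (2 * ⟪x, v⟫_ℝ))
    + 4 * m ^ 2 * ((r - m) / (r + m)) * (eta 0 x u * eta 0 x v)
    + (r ^ 2 - m ^ 2) * (eta 1 x u * eta 1 x v + eta 2 x u * eta 2 x v)

/-- `τ` is the hyperkähler triple of Taub–NUT space of mass `m`, realized on `ℝ⁴ = ℍ` with the nut
`r = m` at the origin. -/
structure IsTaubNUT (m : ℝ) (τ : Fin 3 → TwoForm) : Prop where
  hyperkahler : IsHyperkahlerTriple τ univ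
  eq_rotating : ∀ a, ∀ x ≠ 0, τ a x = rotatingTriple (tnLapse m) (tnProfile m) a x
  metric : ∀ x ≠ 0, InducesMetric (fun a => τ a x) (tnMetric m x)

/-- The triple `τ` on `B⁴ \ {0}` is `SU(2)`-invariant with the frame rotated by the action, of the
form `q (f_a dt ∧ η_a + f_b f_c η_b ∧ η_c) q⁻¹` with smooth radial functions. -/
def IsRotatingInvariant (τ : Fin 3 → TwoForm) : Prop :=
  ∃ (N : ℝ → ℝ) (f : Fin 3 → ℝ → ℝ), ContDiffOn ℝ ∞ N (Ioc 0 1) ∧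
    (∀ a, ContDiffOn ℝ ∞ (f a) (Ioc 0 1)) ∧
    ∀ a, ∀ x ∈ closedBall (0 : ℍ[ℝ]) 1, x ≠ 0 → τ a x = rotatingTriple N f a x

/-- The radial map `x ↦ s(‖x‖) x / ‖x‖`. -/
def radialMap (s : ℝ → ℝ) (x : ℍ[ℝ]) : ℍ[ℝ] := (s ‖x‖ / ‖x‖) • x

end TaubNUTFilling

end

open TaubNUTFilling

noncomputable section

namespace TaubNUTFilling

/-! ### Wedge products -/

/-! Everything takes place among triples `q (H_a ρ dρ ∧ η_a + g_a η_b ∧ η_c) q⁻¹` with radial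
coefficients (`radialTriple`). Two contributions enter the exterior derivative: `dη_a = 2 η_b ∧
η_c`, and the derivative of the rotation `w ↦ q w q⁻¹`, which is a commutator. With `h_a = ρ H_a`,
closedness becomes the system `g_a' = 2 (h_a - h_b - h_c)` (`extDeriv_radialTriple_apply`). Constant
`g` with `H = 0` always solves it, so `q γ̂ q⁻¹` is closed for all constants `c_a`. On the sphere
the same computation shows that `d *` multiplies `q γ̂ q⁻¹` by `-4` when the constants sum to zero
(`dS_star2_conjTriple`). Negative frequency of the difference from the standard framing therefore
follows from `c₁ + c₂ + c₃ = 3`.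

In the Taub–NUT triple only the products `f_a N` and `f_b f_c` occur, and in these the square roots
cancel. The result is a triple polynomial in `x` (`polyTriple` with `A = 2m`, `B = 1`), so it
extends over the origin, and closedness and the wedge relations are polynomial identities. With `L =
r₀ - m`, restriction to the sphere after dilation by `√L` gives `c = (L (L + 2m), 2mL, 2mL)`, and
the sum condition is a quadratic equation for `L` with a positive root.

For uniqueness, put `g_a = f_b f_c` and `h_a = f_a N`. The products `h_a g_a` all equal `f₁ f₂ f₃
N`, so `g₂ - g₃` and `g₁ - S (S + 2m)` with `S = g₂ / (2m)` successively satisfy linear homogeneous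
ODEs and vanish at `ρ = 1` (`structure_equations_unique`). What remains is a choice of radial
parameter, and `s = √S` matches the triple with Taub–NUT. -/

theorem form_two_ext {E : Type*} [NormedAddCommGroup E] [NormedSpace ℝ E]
    {α β : E [⋀^Fin 2]→L[ℝ] ℝ} (h : ∀ u v, α ![u, v] = β ![u, v]) : α = β := by
  ext w
  have e : w = ![w 0, w 1] := by funext i; fin_cases i <;> rfl
  rw [e, h]

/-- The wedge product of covectors as a bilinear map. -/
def wedgeBilin (E : Type*) [NormedAddCommGroup E] [NormedSpace ℝ E] :
    (E →L[ℝ] ℝ) →ₗ[ℝ] (E →L[ℝ] ℝ) →ₗ[ℝ] E [⋀^Fin 2]→L[ℝ] ℝ :=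
  LinearMap.mk₂ ℝ wedge
    (fun α β γ => form_two_ext fun u v => by
      rw [ContinuousAlternatingMap.add_apply, wedge_apply, wedge_apply, wedge_apply, add_apply,
        add_apply]
      ring)
    (fun c α β => form_two_ext fun u v => by
      rw [ContinuousAlternatingMap.smul_apply, wedge_apply, wedge_apply, smul_apply, smul_apply,
        smul_eq_mul, smul_eq_mul, smul_eq_mul]
      ring)
    (fun α β γ => form_two_ext fun u v => by
      rw [ContinuousAlternatingMap.add_apply, wedge_apply, wedge_apply, wedge_apply, add_apply,
        add_apply]
      ring)
    (fun c α β => form_two_ext fun u v => by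
      rw [ContinuousAlternatingMap.smul_apply, wedge_apply, wedge_apply, smul_apply, smul_apply,
        smul_eq_mul, smul_eq_mul, smul_eq_mul]
      ring)

theorem contDiffOn_bilin {E V G : Type*} [NormedAddCommGroup E] [NormedSpace ℝ E]
    [NormedAddCommGroup V] [NormedSpace ℝ V] [FiniteDimensional ℝ V] [NormedAddCommGroup G]
    [NormedSpace ℝ G] (B : V →ₗ[ℝ] V →ₗ[ℝ] G) {f g : E → V} {s : Set E}
    (hf : ContDiffOn ℝ ∞ f s) (hg : ContDiffOn ℝ ∞ g s) :
    ContDiffOn ℝ ∞ (fun x => B (f x) (g x)) s :=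
  (B.toContinuousBilinearMap.contDiff.comp_contDiffOn hf).clm_apply hg

theorem contDiffOn_wedge {E : Type*} [NormedAddCommGroup E] [NormedSpace ℝ E]
    [FiniteDimensional ℝ E] {f g : E → E →L[ℝ] ℝ} {s : Set E} (hf : ContDiffOn ℝ ∞ f s)
    (hg : ContDiffOn ℝ ∞ g s) : ContDiffOn ℝ ∞ (fun x => wedge (f x) (g x)) s :=
  contDiffOn_bilin (wedgeBilin E) hf hg

theorem hasDerivAt_line {E : Type*} [NormedAddCommGroup E] [NormedSpace ℝ E] (x u : E) :
    HasDerivAt (fun t : ℝ => x + t • u) u 0 := by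
  simpa using ((hasDerivAt_id (0 : ℝ)).smul_const u).const_add x

/-! ### Exterior derivatives from derivatives along lines -/

theorem fderiv_apply_of_hasDerivAt_line {E : Type*} [NormedAddCommGroup E] [NormedSpace ℝ E]
    {n : ℕ} {τ : E → E [⋀^Fin n]→L[ℝ] ℝ} {x : E}
    (hτ : DifferentiableAt ℝ τ x) {u : E} {w : Fin n → E} {d : ℝ}
    (h : HasDerivAt (fun t : ℝ => τ (x + t • u) w) d 0) : fderiv ℝ τ x u w = d := by
  have h0 : HasFDerivAt τ (fderiv ℝ τ x) (x + (0 : ℝ) • u) := by simpa using hτ.hasFDerivAt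
  have h1 := h0.comp_hasDerivAt 0 (hasDerivAt_line x u)
  have h2 := ((ContinuousAlternatingMap.apply ℝ E ℝ w).hasFDerivAt).comp_hasDerivAt 0 h1
  exact h2.unique h

/-- Constant vector fields commute, so no bracket terms occur, and a closedness check reduces to
three one-variable derivatives. -/
theorem extDeriv_apply_three {E : Type*} [NormedAddCommGroup E] [NormedSpace ℝ E]
    {τ : E → E [⋀^Fin 2]→L[ℝ] ℝ} {x : E} (hτ : DifferentiableAt ℝ τ x)
    {u v w : E} {a b c : ℝ} (ha : HasDerivAt (fun t : ℝ => τ (x + t • u) ![v, w]) a 0)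
    (hb : HasDerivAt (fun t : ℝ => τ (x + t • v) ![u, w]) b 0)
    (hc : HasDerivAt (fun t : ℝ => τ (x + t • w) ![u, v]) c 0) :
    extDeriv τ x ![u, v, w] = a - b + c := by
  have e0 : Fin.removeNth 0 ![u, v, w] = ![v, w] := by funext i; fin_cases i <;> rfl
  have e1 : Fin.removeNth 1 ![u, v, w] = ![u, w] := by funext i; fin_cases i <;> rfl
  have e2 : Fin.removeNth 2 ![u, v, w] = ![u, v] := by funext i; fin_cases i <;> rfl
  rw [extDeriv, ContinuousAlternatingMap.alternatizeUncurryFin_apply, Fin.sum_univ_three,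
    e0, e1, e2]
  simp only [Matrix.cons_val]
  rw [fderiv_apply_of_hasDerivAt_line hτ ha, fderiv_apply_of_hasDerivAt_line hτ hb,
    fderiv_apply_of_hasDerivAt_line hτ hc]
  simp
  ring

theorem extDeriv_apply_two {E : Type*} [NormedAddCommGroup E] [NormedSpace ℝ E]
    {τ : E → E [⋀^Fin 1]→L[ℝ] ℝ} {x : E}
    (hτ : DifferentiableAt ℝ τ x) {u v : E} {a b : ℝ}
    (ha : HasDerivAt (fun t : ℝ => τ (x + t • u) ![v]) a 0)
    (hb : HasDerivAt (fun t : ℝ => τ (x + t • v) ![u]) b 0) :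
    extDeriv τ x ![u, v] = a - b := by
  have e0 : Fin.removeNth 0 ![u, v] = ![v] := by funext i; fin_cases i; rfl
  have e1 : Fin.removeNth 1 ![u, v] = ![u] := by funext i; fin_cases i; rfl
  rw [extDeriv, ContinuousAlternatingMap.alternatizeUncurryFin_apply, Fin.sum_univ_two, e0, e1]
  simp only [Matrix.cons_val]
  rw [fderiv_apply_of_hasDerivAt_line hτ ha, fderiv_apply_of_hasDerivAt_line hτ hb]
  simp
  ring

/-! ### Coordinates of quaternions -/

@[simp] theorem re_imUnit (a : Fin 3) : (imUnit a).re = 0 := by fin_cases a <;> rfl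

@[simp] theorem imI_imUnit (a : Fin 3) : (imUnit a).imI = ![1, 0, 0] a := by fin_cases a <;> rfl

@[simp] theorem imJ_imUnit (a : Fin 3) : (imUnit a).imJ = ![0, 1, 0] a := by fin_cases a <;> rfl

@[simp] theorem imK_imUnit (a : Fin 3) : (imUnit a).imK = ![0, 0, 1] a := by fin_cases a <;> rfl

theorem inner_imUnit (a : Fin 3) (p : ℍ[ℝ]) :
    ⟪imUnit a, p⟫_ℝ = ![p.imI, p.imJ, p.imK] a := by
  fin_cases a <;> simp [Quaternion.inner_def]

theorem inner_coord (x y : ℍ[ℝ]) :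
    ⟪x, y⟫_ℝ = x.re * y.re + x.imI * y.imI + x.imJ * y.imJ + x.imK * y.imK := by
  simp [Quaternion.inner_def]

theorem norm_sq_coord (x : ℍ[ℝ]) :
    ‖x‖ ^ 2 = x.re ^ 2 + x.imI ^ 2 + x.imJ ^ 2 + x.imK ^ 2 := by
  rw [← real_inner_self_eq_norm_sq, inner_coord]; ring

theorem inner_mul_left_mul_left (x p v : ℍ[ℝ]) : ⟪x * p, x * v⟫_ℝ = ‖x‖ ^ 2 * ⟪p, v⟫_ℝ := by
  simp only [norm_sq_coord, inner_coord, Quaternion.re_mul, Quaternion.imI_mul,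
    Quaternion.imJ_mul, Quaternion.imK_mul]
  ring

theorem inner_mul_right_self (x p : ℍ[ℝ]) : ⟪x, x * p⟫_ℝ = ‖x‖ ^ 2 * p.re := by
  have h := inner_mul_left_mul_left x 1 p
  rw [mul_one] at h
  rw [h, inner_coord]; simp

theorem eta_apply (a : Fin 3) (x v : ℍ[ℝ]) : eta a x v = -⟪imUnit a, x⁻¹ * v⟫_ℝ := rfl

theorem eta_apply_mul (a : Fin 3) {x : ℍ[ℝ]} (hx : x ≠ 0) (p : ℍ[ℝ]) :
    eta a x (x * p) = -⟪imUnit a, p⟫_ℝ := by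
  rw [eta_apply, inv_mul_cancel_left₀ hx]

theorem inv_eq_star (x : ℍ[ℝ]) : x⁻¹ = (‖x‖ ^ 2)⁻¹ • star x := by
  rw [Quaternion.inv_def, Quaternion.normSq_eq_norm_mul_self, sq]

theorem inner_imUnit_decomp {w : ℍ[ℝ]} (hw : w.re = 0) :
    w = ∑ c : Fin 3, ⟪imUnit c, w⟫_ℝ • imUnit c := by
  rw [Fin.sum_univ_three]
  simp only [inner_imUnit]
  ext <;> simp [hw]

/-! ### The rotations `rot x` -/

/-- `‖x‖ ^ 2 * rot x a b`, which is polynomial in `x`. -/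
def rotPoly (x : ℍ[ℝ]) (a b : Fin 3) : ℝ := ⟪imUnit a, x * imUnit b * star x⟫_ℝ

theorem rot_eq (x : ℍ[ℝ]) (a b : Fin 3) : rot x a b = (‖x‖ ^ 2)⁻¹ * rotPoly x a b := by
  rw [rot, rotPoly, inv_eq_star, mul_smul_comm, inner_smul_right]

theorem rotPoly_eq_matrix (x : ℍ[ℝ]) (a b : Fin 3) : rotPoly x a b =
    !![x.re ^ 2 + x.imI ^ 2 - x.imJ ^ 2 - x.imK ^ 2, 2 * (x.imI * x.imJ - x.re * x.imK),
        2 * (x.imI * x.imK + x.re * x.imJ);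
      2 * (x.imI * x.imJ + x.re * x.imK), x.re ^ 2 - x.imI ^ 2 + x.imJ ^ 2 - x.imK ^ 2,
        2 * (x.imJ * x.imK - x.re * x.imI);
      2 * (x.imI * x.imK - x.re * x.imJ), 2 * (x.imJ * x.imK + x.re * x.imI),
        x.re ^ 2 - x.imI ^ 2 - x.imJ ^ 2 + x.imK ^ 2] a b := by
  rw [rotPoly, inner_imUnit]
  fin_cases a <;> fin_cases b <;> simp <;> ring

theorem sum_rot_mul_rot_left {x : ℍ[ℝ]} (hx : x ≠ 0) (b c : Fin 3) :
    ∑ a, rot x a b * rot x a c = if b = c then 1 else 0 := by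
  have hn : ‖x‖ ^ 2 ≠ 0 := by positivity
  have h : ∑ a, rotPoly x a b * rotPoly x a c = if b = c then (‖x‖ ^ 2) ^ 2 else 0 := by
    rw [norm_sq_coord, Fin.sum_univ_three]
    simp only [rotPoly_eq_matrix]
    fin_cases b <;> fin_cases c <;> simp <;> ring
  simp only [rot_eq, mul_mul_mul_comm, ← Finset.mul_sum, h]
  split_ifs
  · field_simp
  · simp

theorem sum_rot_mul_rot_right {x : ℍ[ℝ]} (hx : x ≠ 0) (a b : Fin 3) :
    ∑ c, rot x a c * rot x b c = if a = b then 1 else 0 := by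
  have hn : ‖x‖ ^ 2 ≠ 0 := by positivity
  have h : ∑ c, rotPoly x a c * rotPoly x b c = if a = b then (‖x‖ ^ 2) ^ 2 else 0 := by
    rw [norm_sq_coord, Fin.sum_univ_three]
    simp only [rotPoly_eq_matrix]
    fin_cases a <;> fin_cases b <;> simp <;> ring
  simp only [rot_eq, mul_mul_mul_comm, ← Finset.mul_sum, h]
  split_ifs
  · field_simp
  · simp

/-- A matrix in `SO(3)` equals its cofactor matrix. Hence conjugation by `q` acts in the same way on
one-forms `η_a` and on two-forms `η_b ∧ η_c`. -/
theorem rot_cofactor {x : ℍ[ℝ]} (hx : x ≠ 0) (a b : Fin 3) :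
    rot x (a + 1) (b + 1) * rot x (a + 2) (b + 2)
      - rot x (a + 1) (b + 2) * rot x (a + 2) (b + 1) = rot x a b := by
  have hn : ‖x‖ ^ 2 ≠ 0 := by positivity
  have h : rotPoly x (a + 1) (b + 1) * rotPoly x (a + 2) (b + 2)
      - rotPoly x (a + 1) (b + 2) * rotPoly x (a + 2) (b + 1) = ‖x‖ ^ 2 * rotPoly x a b := by
    rw [norm_sq_coord]
    simp only [rotPoly_eq_matrix]
    fin_cases a <;> fin_cases b <;> simp <;> ring
  simp only [rot_eq, mul_mul_mul_comm, ← mul_sub, h]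
  field_simp

theorem rot_one (a b : Fin 3) : rot 1 a b = if a = b then 1 else 0 := by
  rw [rot, inner_imUnit]
  fin_cases a <;> fin_cases b <;> simp

theorem rot_smul {l : ℝ} (hl : l ≠ 0) (x : ℍ[ℝ]) (a b : Fin 3) : rot (l • x) a b = rot x a b := by
  have h : (l • x) * imUnit b * (l • x)⁻¹ = x * imUnit b * x⁻¹ := by
    simp [smul_inv₀, smul_smul, hl]
  rw [rot, rot, h]

theorem eta_smul_apply_smul {l : ℝ} (hl : l ≠ 0) (a : Fin 3) (x v : ℍ[ℝ]) :
    eta a (l • x) (l • v) = eta a x v := by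
  simp [eta_apply, smul_inv₀, inner_smul_right, hl]

theorem eta_apply_self (a : Fin 3) (x : ℍ[ℝ]) : eta a x x = 0 := by
  rcases eq_or_ne x 0 with rfl | hx
  · simp
  · have := eta_apply_mul a hx 1
    rw [mul_one] at this
    rw [this, inner_imUnit]
    fin_cases a <;> simp

/-! ### Derivatives along lines -/

theorem hasDerivAt_inv_line {x : ℍ[ℝ]} (hx : x ≠ 0) (u : ℍ[ℝ]) :
    HasDerivAt (fun t : ℝ => (x + t • u)⁻¹) (-(x⁻¹ * u * x⁻¹)) 0 := by
  have h := hasFDerivAt_inv' (𝕜 := ℝ) (x := x + (0 : ℝ) • u) (by simpa using hx)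
  have h2 := h.comp_hasDerivAt 0 (hasDerivAt_line x u)
  simpa [Function.comp_def] using h2

theorem hasDerivAt_eta_line (a : Fin 3) {x : ℍ[ℝ]} (hx : x ≠ 0) (p v : ℍ[ℝ]) :
    HasDerivAt (fun t : ℝ => eta a (x + t • (x * p)) (x * v)) ⟪imUnit a, p * v⟫_ℝ 0 := by
  have h1 := (hasDerivAt_inv_line hx (x * p)).mul_const (x * v)
  have h2 := ((innerSL ℝ (imUnit a)).hasFDerivAt.comp_hasDerivAt 0 h1).neg
  refine h2.congr_deriv ?_
  rw [inv_mul_cancel_left₀ hx, neg_mul, mul_assoc, inv_mul_cancel_left₀ hx]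
  simp

/-- In the left-translated direction `x p`, the derivative of `x w x⁻¹` is `x [p, w] x⁻¹`. The
commutator is imaginary, so it expands in the units and the derivative is again a combination of
entries of `rot x`. -/
theorem hasDerivAt_rot_line {x : ℍ[ℝ]} (hx : x ≠ 0) (a b : Fin 3) (p : ℍ[ℝ]) :
    HasDerivAt (fun t : ℝ => rot (x + t • (x * p)) a b)
      (∑ c, rot x a c * ⟪imUnit c, p * imUnit b - imUnit b * p⟫_ℝ) 0 := by
  have h1 := ((hasDerivAt_line x (x * p)).mul_const (imUnit b)).mul (hasDerivAt_inv_line hx (x * p))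
  have h2 := (innerSL ℝ (imUnit a)).hasFDerivAt.comp_hasDerivAt 0 h1
  refine h2.congr_deriv ?_
  have e1 : x * p * imUnit b * (x + (0 : ℝ) • (x * p))⁻¹
      + (x + (0 : ℝ) • (x * p)) * imUnit b * -(x⁻¹ * (x * p) * x⁻¹)
      = x * (p * imUnit b - imUnit b * p) * x⁻¹ := by
    rw [inv_mul_cancel_left₀ hx]
    simp only [zero_smul, add_zero]
    noncomm_ring
  rw [e1]
  have e2 : (p * imUnit b - imUnit b * p).re = 0 := by
    simp only [Quaternion.re_sub, Quaternion.re_mul]; ring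
  conv_lhs => rw [inner_imUnit_decomp e2]
  simp only [rot, Finset.mul_sum, Finset.sum_mul, map_sum, mul_smul_comm, smul_mul_assoc,
    map_smul, innerSL_apply_apply, smul_eq_mul]
  exact Finset.sum_congr rfl fun c _ => mul_comm (_ : ℝ) _

theorem hasDerivAt_norm_line {x : ℍ[ℝ]} (hx : x ≠ 0) (p : ℍ[ℝ]) :
    HasDerivAt (fun t : ℝ => ‖x + t • (x * p)‖) (‖x‖ * p.re) 0 := by
  have hn : ‖x‖ ≠ 0 := by positivity
  have h1 := ((hasDerivAt_line x (x * p)).norm_sq).sqrt (by simpa using hx)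
  simp only [Real.sqrt_sq (norm_nonneg _)] at h1
  refine h1.congr_deriv ?_
  rw [zero_smul, add_zero, inner_mul_right_self]
  field_simp

/-! ### Smoothness of the coframe and the rotations -/

theorem contDiffOn_inv : ContDiffOn ℝ ∞ (fun x : ℍ[ℝ] => x⁻¹) {0}ᶜ := by
  intro x hx
  have h := (contDiffAt_ringInverse ℝ (n := ∞) (Units.mk0 x hx)).contDiffWithinAt (s := {0}ᶜ)
  rw [Ring.inverse_eq_inv'] at h
  exact h

theorem contDiffOn_eta (a : Fin 3) : ContDiffOn ℝ ∞ (eta a) {0}ᶜ := by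
  unfold eta
  exact (contDiffOn_const.clm_comp
    ((ContinuousLinearMap.mul ℝ ℍ[ℝ]).contDiff.comp_contDiffOn contDiffOn_inv)).neg

theorem contDiffOn_rot (a b : Fin 3) : ContDiffOn ℝ ∞ (fun x => rot x a b) {0}ᶜ := by
  unfold rot
  exact contDiffOn_const.inner ℝ ((contDiffOn_id.mul contDiffOn_const).mul contDiffOn_inv)

/-! ### Rotating forms with radial coefficients -/

/-- The triple given on `ℍ \ {0}` by `q (H_a ρ dρ ∧ η_a + g_a η_b ∧ η_c) q⁻¹`. -/
def radialTriple (H g : Fin 3 → ℝ → ℝ) : Fin 3 → TwoForm := fun a x =>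
  ∑ b : Fin 3, rot x a b •
    (H b ‖x‖ • wedge (innerSL ℝ x) (eta b x) + g b ‖x‖ • wedge (eta (b + 1) x) (eta (b + 2) x))

theorem radialTriple_apply (H g : Fin 3 → ℝ → ℝ) (a : Fin 3) (x u v : ℍ[ℝ]) :
    radialTriple H g a x ![u, v] = ∑ b : Fin 3, rot x a b *
      (H b ‖x‖ * (⟪x, u⟫_ℝ * eta b x v - ⟪x, v⟫_ℝ * eta b x u)
        + g b ‖x‖ * (eta (b + 1) x u * eta (b + 2) x v - eta (b + 1) x v * eta (b + 2) x u)) := by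
  simp only [radialTriple, Fin.sum_univ_three, ContinuousAlternatingMap.add_apply,
    ContinuousAlternatingMap.smul_apply, wedge_apply, innerSL_apply_apply, smul_eq_mul]

theorem rotatingTriple_eq_radialTriple (N : ℝ → ℝ) (f : Fin 3 → ℝ → ℝ) :
    rotatingTriple N f = radialTriple (fun b ρ => f b ρ * N ρ / ρ)
      (fun b ρ => f (b + 1) ρ * f (b + 2) ρ) := by
  ext1 a
  ext1 x
  refine form_two_ext fun u v => ?_
  rw [radialTriple_apply]
  simp only [rotatingTriple, Fin.sum_univ_three, ContinuousAlternatingMap.add_apply,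
    ContinuousAlternatingMap.smul_apply, wedge_apply, innerSL_apply_apply, smul_eq_mul,
    real_inner_smul_left]
  ring

theorem radialTriple_apply_mul (H g : Fin 3 → ℝ → ℝ) (a : Fin 3) {x : ℍ[ℝ]} (hx : x ≠ 0)
    (p v : ℍ[ℝ]) :
    radialTriple H g a x ![x * p, x * v] = ∑ b : Fin 3, rot x a b *
      (H b ‖x‖ * ‖x‖ ^ 2 * (v.re * ⟪imUnit b, p⟫_ℝ - p.re * ⟪imUnit b, v⟫_ℝ)
        + g b ‖x‖ * (⟪imUnit (b + 1), p⟫_ℝ * ⟪imUnit (b + 2), v⟫_ℝ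
          - ⟪imUnit (b + 1), v⟫_ℝ * ⟪imUnit (b + 2), p⟫_ℝ)) := by
  rw [radialTriple_apply]
  simp only [eta_apply_mul _ hx, inner_mul_right_self, Fin.sum_univ_three]
  ring

theorem hasDerivAt_radialTriple_line {H g : Fin 3 → ℝ → ℝ} (a : Fin 3) {x : ℍ[ℝ]} (hx : x ≠ 0)
    {H' g' : Fin 3 → ℝ} (hH : ∀ b, HasDerivAt (H b) (H' b) ‖x‖)
    (hg : ∀ b, HasDerivAt (g b) (g' b) ‖x‖) (p v w : ℍ[ℝ]) :
    HasDerivAt (fun t : ℝ => radialTriple H g a (x + t • (x * p)) ![x * v, x * w])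
      (∑ b : Fin 3,
        ((∑ c, rot x a c * ⟪imUnit c, p * imUnit b - imUnit b * p⟫_ℝ) *
          (H b ‖x‖ * ‖x‖ ^ 2 * (w.re * ⟪imUnit b, v⟫_ℝ - v.re * ⟪imUnit b, w⟫_ℝ)
            + g b ‖x‖ * (⟪imUnit (b + 1), v⟫_ℝ * ⟪imUnit (b + 2), w⟫_ℝ
              - ⟪imUnit (b + 1), w⟫_ℝ * ⟪imUnit (b + 2), v⟫_ℝ))
        + rot x a b *
          (H' b * (‖x‖ * p.re) * ‖x‖ ^ 2 * (w.re * ⟪imUnit b, v⟫_ℝ - v.re * ⟪imUnit b, w⟫_ℝ)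
            + H b ‖x‖ * ‖x‖ ^ 2 *
              (⟪p, v⟫_ℝ * -⟪imUnit b, w⟫_ℝ + v.re * ⟪imUnit b, p * w⟫_ℝ
                - (⟪p, w⟫_ℝ * -⟪imUnit b, v⟫_ℝ + w.re * ⟪imUnit b, p * v⟫_ℝ))
            + g' b * (‖x‖ * p.re) * (⟪imUnit (b + 1), v⟫_ℝ * ⟪imUnit (b + 2), w⟫_ℝ
              - ⟪imUnit (b + 1), w⟫_ℝ * ⟪imUnit (b + 2), v⟫_ℝ)
            + g b ‖x‖ *
              (⟪imUnit (b + 1), p * v⟫_ℝ * -⟪imUnit (b + 2), w⟫_ℝ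
                + -⟪imUnit (b + 1), v⟫_ℝ * ⟪imUnit (b + 2), p * w⟫_ℝ
                - (⟪imUnit (b + 1), p * w⟫_ℝ * -⟪imUnit (b + 2), v⟫_ℝ
                  + -⟪imUnit (b + 1), w⟫_ℝ * ⟪imUnit (b + 2), p * v⟫_ℝ))))) 0 := by
  simp only [radialTriple_apply]
  refine HasDerivAt.fun_sum fun b _ => ?_
  have h0 : x + (0 : ℝ) • (x * p) = x := by simp
  have hn := hasDerivAt_norm_line hx p
  have hHn : HasDerivAt (fun t : ℝ => H b ‖x + t • (x * p)‖) (H' b * (‖x‖ * p.re)) 0 :=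
    HasDerivAt.comp 0 (by rw [h0]; exact hH b) hn
  have hgn : HasDerivAt (fun t : ℝ => g b ‖x + t • (x * p)‖) (g' b * (‖x‖ * p.re)) 0 :=
    HasDerivAt.comp 0 (by rw [h0]; exact hg b) hn
  have hi : ∀ v : ℍ[ℝ], HasDerivAt (fun t : ℝ => ⟪x + t • (x * p), x * v⟫_ℝ)
      (‖x‖ ^ 2 * ⟪p, v⟫_ℝ) 0 := fun v => by
    have := (hasDerivAt_line x (x * p)).inner ℝ (hasDerivAt_const (0 : ℝ) (x * v))
    refine this.congr_deriv ?_
    rw [inner_zero_right, zero_add, inner_mul_left_mul_left]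
  have he := fun a v => hasDerivAt_eta_line a hx p v
  have key := (hasDerivAt_rot_line hx a b p).fun_mul
    ((hHn.fun_mul (((hi v).fun_mul (he b w)).fun_sub ((hi w).fun_mul (he b v)))).fun_add
      (hgn.fun_mul (((he (b + 1) v).fun_mul (he (b + 2) w)).fun_sub
        ((he (b + 1) w).fun_mul (he (b + 2) v)))))
  refine key.congr_deriv ?_
  simp only [h0, eta_apply_mul _ hx, inner_mul_right_self]
  ring

/-- On left-translated vectors `x p` the forms `η_a` and `ρ dρ` have coefficients depending at most
on `‖x‖`, and only the rotation depends on the direction of `x`. Its commutator term combines with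
`dη_a = 2 η_b ∧ η_c` into the bracket `H (c + 1) + H (c + 2) - H c`, and the last factor is, up to
scale, `dρ ∧ η_b ∧ η_c`. -/
theorem extDeriv_radialTriple_apply {H g : Fin 3 → ℝ → ℝ} (a : Fin 3) {x : ℍ[ℝ]} (hx : x ≠ 0)
    (hτ : DifferentiableAt ℝ (radialTriple H g a) x)
    {H' g' : Fin 3 → ℝ} (hH : ∀ b, HasDerivAt (H b) (H' b) ‖x‖)
    (hg : ∀ b, HasDerivAt (g b) (g' b) ‖x‖) (p v w : ℍ[ℝ]) :
    extDeriv (radialTriple H g a) x ![x * p, x * v, x * w] =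
      ∑ c : Fin 3, rot x a c *
        (‖x‖ * g' c + 2 * ‖x‖ ^ 2 * (H (c + 1) ‖x‖ + H (c + 2) ‖x‖ - H c ‖x‖)) *
        (p.re * (⟪imUnit (c + 1), v⟫_ℝ * ⟪imUnit (c + 2), w⟫_ℝ
            - ⟪imUnit (c + 2), v⟫_ℝ * ⟪imUnit (c + 1), w⟫_ℝ)
          - v.re * (⟪imUnit (c + 1), p⟫_ℝ * ⟪imUnit (c + 2), w⟫_ℝ
            - ⟪imUnit (c + 2), p⟫_ℝ * ⟪imUnit (c + 1), w⟫_ℝ)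
          + w.re * (⟪imUnit (c + 1), p⟫_ℝ * ⟪imUnit (c + 2), v⟫_ℝ
            - ⟪imUnit (c + 2), p⟫_ℝ * ⟪imUnit (c + 1), v⟫_ℝ)) := by
  rw [extDeriv_apply_three hτ (hasDerivAt_radialTriple_line a hx hH hg p v w)
    (hasDerivAt_radialTriple_line a hx hH hg v p w) (hasDerivAt_radialTriple_line a hx hH hg w p v)]
  simp only [Fin.sum_univ_three, inner_coord, Quaternion.imI_sub, Quaternion.imJ_sub,
    Quaternion.imK_sub, Quaternion.imI_mul, Quaternion.imJ_mul, Quaternion.imK_mul, re_imUnit,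
    imI_imUnit, imJ_imUnit, imK_imUnit, Fin.isValue, Fin.reduceAdd, zero_add, Matrix.cons_val]
  ring

theorem contDiffOn_smul_of_real {E F : Type*} [NormedAddCommGroup E] [NormedSpace ℝ E]
    [NormedAddCommGroup F] [NormedSpace ℝ F] {f : E → ℝ} {g : E → F} {s : Set E}
    (hf : ContDiffOn ℝ ∞ f s) (hg : ContDiffOn ℝ ∞ g s) :
    ContDiffOn ℝ ∞ (fun x => f x • g x) s :=
  hf.smul hg

theorem contDiffOn_radialTriple_const (k : Fin 3 → ℝ) (a : Fin 3) :
    ContDiffOn ℝ ∞ (radialTriple 0 (fun b _ => k b) a) {0}ᶜ := by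
  have h : radialTriple 0 (fun b _ => k b) a = fun x => ∑ b : Fin 3,
      rot x a b • k b • wedge (eta (b + 1) x) (eta (b + 2) x) := by
    funext x
    simp [radialTriple]
  rw [h]
  exact ContDiffOn.sum fun b _ => contDiffOn_smul_of_real (contDiffOn_rot a b)
    (contDiffOn_smul_of_real contDiffOn_const
      (contDiffOn_wedge (contDiffOn_eta _) (contDiffOn_eta _)))

theorem differentiableAt_of_contDiffOn_compl {F : Type*} [NormedAddCommGroup F] [NormedSpace ℝ F]
    {f : ℍ[ℝ] → F} (hf : ContDiffOn ℝ ∞ f {0}ᶜ) {x : ℍ[ℝ]} (hx : x ≠ 0) :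
    DifferentiableAt ℝ f x :=
  (hf.contDiffAt (isOpen_compl_singleton.mem_nhds hx)).differentiableAt (by simp)

theorem form_ext_mul {n : ℕ} {x : ℍ[ℝ]} (hx : x ≠ 0) {α β : ℍ[ℝ] [⋀^Fin n]→L[ℝ] ℝ}
    (h : ∀ p : Fin n → ℍ[ℝ], α (fun i => x * p i) = β (fun i => x * p i)) : α = β := by
  ext w
  have e : w = fun i => x * (x⁻¹ * w i) := by
    funext i
    rw [mul_inv_cancel_left₀ hx]
  rw [e, h]

theorem extDeriv_radialTriple_const (k : Fin 3 → ℝ) (a : Fin 3) {x : ℍ[ℝ]} (hx : x ≠ 0) :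
    extDeriv (radialTriple 0 (fun b _ => k b) a) x = 0 := by
  refine form_ext_mul hx fun p => ?_
  have e : (fun i => x * p i) = ![x * p 0, x * p 1, x * p 2] := by
    funext i; fin_cases i <;> rfl
  rw [e, extDeriv_radialTriple_apply a hx
    (differentiableAt_of_contDiffOn_compl (contDiffOn_radialTriple_const k a) hx)
    (H' := 0) (g' := 0) (fun b => hasDerivAt_const _ _) (fun b => hasDerivAt_const _ _)]
  simp

/-! ### Invariant forms on the three-sphere -/

theorem form_two_comp_apply {E F : Type*} [NormedAddCommGroup E] [NormedSpace ℝ E]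
    [NormedAddCommGroup F] [NormedSpace ℝ F] (α : F [⋀^Fin 2]→L[ℝ] ℝ) (L : E →L[ℝ] F) (u v : E) :
    α.compContinuousLinearMap L ![u, v] = α ![L u, L v] := by
  rw [ContinuousAlternatingMap.compContinuousLinearMap_apply]
  congr 1
  funext i; fin_cases i <;> rfl

theorem S3.ne_zero (q : S3) : (q : ℍ[ℝ]) ≠ 0 := ne_zero_of_mem_unit_sphere q

theorem S3.norm_eq (q : S3) : ‖(q : ℍ[ℝ])‖ = 1 := norm_eq_of_mem_sphere q

theorem eta_projection (a : Fin 3) (q : S3) (u : ℍ[ℝ]) :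
    eta a q ((Tan q).orthogonalProjectionOnto u : ℍ[ℝ]) = eta a q u := by
  have h : (u - (Tan q).orthogonalProjectionOnto u : ℍ[ℝ]) ∈ (Tan q)ᗮ :=
    Submodule.sub_starProjection_mem_orthogonal u
  rw [Submodule.orthogonal_orthogonal, Submodule.mem_span_singleton] at h
  obtain ⟨c, hc⟩ := h
  have h2 : eta a q (u - (Tan q).orthogonalProjectionOnto u : ℍ[ℝ]) = 0 := by
    rw [← hc, map_smul, eta_apply_self, smul_zero]
  rw [map_sub, sub_eq_zero] at h2
  exact h2.symm

theorem eta_toSphere (a : Fin 3) {x : ℍ[ℝ]} (hx : x ≠ 0) (u : ℍ[ℝ]) :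
    eta a (toSphere x hx) (((‖x‖⁻¹ • (Tan (toSphere x hx)).orthogonalProjectionOnto) u :
      Tan (toSphere x hx)) : ℍ[ℝ]) = eta a x u := by
  have hn : ‖x‖⁻¹ ≠ 0 := by positivity
  rw [smul_apply, Submodule.coe_smul, map_smul, eta_projection, ← map_smul]
  exact eta_smul_apply_smul hn a x u

theorem conjTriple_apply (k : Fin 3 → ℝ) (a : Fin 3) (q : S3) (u v : Tan q) :
    conjTriple (leftInvariantTriple k) a q ![u, v] = ∑ b : Fin 3, rot q a b * (k b *
      (eta (b + 1) q u * eta (b + 2) q v - eta (b + 1) q v * eta (b + 2) q u)) := by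
  simp only [conjTriple, leftInvariantTriple, restrictSphere, Fin.sum_univ_three,
    ContinuousAlternatingMap.add_apply, ContinuousAlternatingMap.smul_apply, form_two_comp_apply,
    wedge_apply, smul_eq_mul, Submodule.subtypeL_apply]

/-- Both `rot` and `η` are invariant under dilations, and `η` annihilates the radial direction. The
pull-back along `x / ‖x‖` therefore has the same formula as the form on the sphere. -/
theorem radialExt_conjTriple (k : Fin 3 → ℝ) (a : Fin 3) {x : ℍ[ℝ]} (hx : x ≠ 0) :
    radialExt (conjTriple (leftInvariantTriple k) a) x = radialTriple 0 (fun b _ => k b) a x := by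
  have hn : ‖x‖⁻¹ ≠ 0 := by positivity
  have hr : ∀ b, rot (toSphere x hx) a b = rot x a b := rot_smul hn x a
  refine form_two_ext fun u v => ?_
  rw [radialExt, dif_pos hx, form_two_comp_apply, conjTriple_apply, radialTriple_apply]
  simp only [eta_toSphere, hr]
  simp

theorem isSmoothForm_conjTriple (k : Fin 3 → ℝ) (a : Fin 3) :
    IsSmoothForm (conjTriple (leftInvariantTriple k) a) :=
  (contDiffOn_radialTriple_const k a).congr fun _ hx => radialExt_conjTriple k a hx

theorem dS_eq_of_eqOn {k : ℕ} {α : SphereForm k} {τ : ℍ[ℝ] → ℍ[ℝ] [⋀^Fin k]→L[ℝ] ℝ}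
    (h : ∀ x ≠ 0, radialExt α x = τ x) : dS α = restrictSphere (extDeriv τ) := by
  funext q
  have he : radialExt α =ᶠ[nhds (q : ℍ[ℝ])] τ := by
    filter_upwards [isOpen_compl_singleton.mem_nhds q.ne_zero] with x hx using h x hx
  rw [dS, restrictSphere, he.extDeriv_eq, restrictSphere]

theorem dS_conjTriple (k : Fin 3 → ℝ) (a : Fin 3) :
    dS (conjTriple (leftInvariantTriple k) a) = 0 := by
  rw [dS_eq_of_eqOn fun x hx => radialExt_conjTriple k a hx]
  funext q
  rw [restrictSphere, extDeriv_radialTriple_const k a q.ne_zero]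
  rfl

theorem eta_frame (q : S3) (a b : Fin 3) : eta a q (frame q b : ℍ[ℝ]) = if a = b then -1 else 0 := by
  rw [frame, eta_apply_mul a q.ne_zero, inner_imUnit]
  fin_cases a <;> fin_cases b <;> simp

theorem conjTriple_frame (k : Fin 3 → ℝ) (a b : Fin 3) (q : S3) :
    conjTriple (leftInvariantTriple k) a q ![frame q (b + 1), frame q (b + 2)]
      = rot q a b * k b := by
  rw [conjTriple_apply]
  simp only [eta_frame, Fin.sum_univ_three]
  fin_cases b <;> simp

theorem isClosedFraming_conjTriple {k : Fin 3 → ℝ} (hk : ∀ b, k b ≠ 0) :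
    IsClosedFraming (conjTriple (leftInvariantTriple k)) where
  smooth := isSmoothForm_conjTriple k
  closed := dS_conjTriple k
  framing q := by
    rw [Fintype.linearIndependent_iff]
    intro g hg a
    have h1 : ∀ b, ∑ a, g a * rot q a b = 0 := fun b => by
      have h2 : (∑ a, g a • conjTriple (leftInvariantTriple k) a q)
          ![frame q (b + 1), frame q (b + 2)] = 0 := by
        rw [hg]
        rfl
      simp only [ContinuousAlternatingMap.sum_apply, ContinuousAlternatingMap.smul_apply,
        conjTriple_frame, smul_eq_mul, ← mul_assoc,
        ← Finset.sum_mul] at h2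
      exact (mul_eq_zero.1 h2).resolve_right (hk b)
    -- Orthogonality of the rotation recovers the coefficients `g` from their rotated combinations.
    have h3 : ∑ b, (∑ c, g c * rot q c b) * rot q a b = g a := by
      simp only [Finset.sum_mul, mul_assoc]
      rw [Finset.sum_comm]
      simp only [← Finset.mul_sum, sum_rot_mul_rot_right q.ne_zero]
      simp
    rw [← h3]
    simp [h1]

theorem inducesRoundMetric_conjTriple_stdTriple : InducesRoundMetric (conjTriple stdTriple) := by
  intro q a b
  simp only [stdTriple, conjTriple_frame, Pi.one_apply, mul_one]
  exact sum_rot_mul_rot_right q.ne_zero a b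

/-! ### Negative frequency -/

theorem differentiableAt_linear_comp {E V G : Type*} [NormedAddCommGroup E] [NormedSpace ℝ E]
    [NormedAddCommGroup V] [NormedSpace ℝ V] [FiniteDimensional ℝ V] [NormedAddCommGroup G]
    [NormedSpace ℝ G] (L : V →ₗ[ℝ] G) {f : E → V} {x : E} (hf : DifferentiableAt ℝ f x) :
    DifferentiableAt ℝ (fun y => L (f y)) x :=
  (LinearMap.toContinuousLinearMap L).differentiableAt.comp x hf

/-- Covectors as alternating forms of degree one, as a linear map. -/
def covectorForm (E : Type*) [NormedAddCommGroup E] [NormedSpace ℝ E] :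
    (E →L[ℝ] ℝ) →ₗ[ℝ] E [⋀^Fin 1]→L[ℝ] ℝ where
  toFun := ContinuousAlternatingMap.ofSubsingleton ℝ E ℝ (0 : Fin 1)
  map_add' _ _ := rfl
  map_smul' _ _ := rfl

theorem differentiableAt_ofSubsingleton {E : Type*} [NormedAddCommGroup E] [NormedSpace ℝ E]
    [FiniteDimensional ℝ E] {f : E → E →L[ℝ] ℝ} {x : E} (hf : DifferentiableAt ℝ f x) :
    DifferentiableAt ℝ
      (fun y => ContinuousAlternatingMap.ofSubsingleton ℝ E ℝ (0 : Fin 1) (f y)) x :=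
  differentiableAt_linear_comp (covectorForm E) hf

/-- The one-form `q (k_a η_a) q⁻¹` on `ℍ \ {0}`. -/
def rotatedOneForm (k : Fin 3 → ℝ) (a : Fin 3) (x : ℍ[ℝ]) : ℍ[ℝ] →L[ℝ] ℝ :=
  ∑ b : Fin 3, (rot x a b * k b) • eta b x

theorem rotatedOneForm_apply (k : Fin 3 → ℝ) (a : Fin 3) (x v : ℍ[ℝ]) :
    rotatedOneForm k a x v = ∑ b : Fin 3, rot x a b * k b * eta b x v := by
  simp only [rotatedOneForm, Fin.sum_univ_three, add_apply, smul_apply, smul_eq_mul]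

theorem contDiffOn_rotatedOneForm (k : Fin 3 → ℝ) (a : Fin 3) :
    ContDiffOn ℝ ∞ (rotatedOneForm k a) {0}ᶜ := by
  unfold rotatedOneForm
  exact ContDiffOn.sum fun b _ => contDiffOn_smul_of_real
    ((contDiffOn_rot a b).mul contDiffOn_const) (contDiffOn_eta b)

theorem star2_conjTriple_apply (k : Fin 3 → ℝ) (a : Fin 3) (q : S3) (u : Tan q) :
    star2 (conjTriple (leftInvariantTriple k) a) q ![u] = -rotatedOneForm k a q u := by
  have h : ∀ b, ⟪frame q b, u⟫_ℝ = -eta b q u := fun b => by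
    have e : (u : ℍ[ℝ]) = q * ((q : ℍ[ℝ])⁻¹ * u) := by rw [mul_inv_cancel_left₀ q.ne_zero]
    rw [Submodule.coe_inner, e, frame, eta_apply_mul b q.ne_zero, inner_mul_left_mul_left,
      q.norm_eq, neg_neg, one_pow, one_mul]
  simp only [star2, conjTriple_frame, rotatedOneForm,
    ContinuousAlternatingMap.ofSubsingleton_apply_apply, Matrix.cons_val_fin_one,
    Fin.sum_univ_three, add_apply, smul_apply, innerSL_apply_apply, h, smul_eq_mul]
  ring

theorem radialExt_star2_conjTriple (k : Fin 3 → ℝ) (a : Fin 3) {x : ℍ[ℝ]} (hx : x ≠ 0) :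
    radialExt (star2 (conjTriple (leftInvariantTriple k) a)) x =
      ContinuousAlternatingMap.ofSubsingleton ℝ ℍ[ℝ] ℝ (0 : Fin 1) (-rotatedOneForm k a x) := by
  have hn : ‖x‖⁻¹ ≠ 0 := by positivity
  have hr : ∀ b, rot (toSphere x hx) a b = rot x a b := rot_smul hn x a
  ext w
  rw [radialExt, dif_pos hx, ContinuousAlternatingMap.compContinuousLinearMap_apply]
  have e := star2_conjTriple_apply k a (toSphere x hx)
    ((‖x‖⁻¹ • (Tan (toSphere x hx)).orthogonalProjectionOnto) (w 0))
  have e2 : ![(‖x‖⁻¹ • (Tan (toSphere x hx)).orthogonalProjectionOnto) (w 0)]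
      = (‖x‖⁻¹ • (Tan (toSphere x hx)).orthogonalProjectionOnto) ∘ w := by
    funext i; fin_cases i; rfl
  rw [← e2, e, ContinuousAlternatingMap.ofSubsingleton_apply_apply, neg_apply,
    rotatedOneForm_apply, rotatedOneForm_apply]
  simp only [eta_toSphere, hr]

theorem hasDerivAt_rotatedOneForm_line (k : Fin 3 → ℝ) (a : Fin 3) {x : ℍ[ℝ]} (hx : x ≠ 0)
    (p v : ℍ[ℝ]) :
    HasDerivAt (fun t : ℝ => rotatedOneForm k a (x + t • (x * p)) (x * v))
      (∑ b, ((∑ c, rot x a c * ⟪imUnit c, p * imUnit b - imUnit b * p⟫_ℝ) * k b *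
        -⟪imUnit b, v⟫_ℝ + rot x a b * k b * ⟪imUnit b, p * v⟫_ℝ)) 0 := by
  simp only [rotatedOneForm_apply]
  refine HasDerivAt.fun_sum fun b _ => ?_
  refine (((hasDerivAt_rot_line hx a b p).mul_const (k b)).fun_mul
    (hasDerivAt_eta_line b hx p v)).congr_deriv ?_
  simp only [zero_smul, add_zero, eta_apply_mul b hx]

/-- Since `η_a` is `-1` on its frame vector, `*` produces `-q (k_a η_a) q⁻¹`, whose derivative has
coefficients `2 (k_b + k_c - k_a)`. For a zero sum this is `-4 k_a`. -/
theorem dS_star2_conjTriple {k : Fin 3 → ℝ} (hk : k 0 + k 1 + k 2 = 0) (a : Fin 3) :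
    dS (star2 (conjTriple (leftInvariantTriple k) a))
      = (-4 : ℝ) • conjTriple (leftInvariantTriple k) a := by
  rw [dS_eq_of_eqOn fun x hx => radialExt_star2_conjTriple k a hx]
  funext q
  refine form_two_ext fun u v => ?_
  have hq := q.ne_zero
  have hd : DifferentiableAt ℝ (fun x => ContinuousAlternatingMap.ofSubsingleton ℝ ℍ[ℝ] ℝ
      (0 : Fin 1) (-rotatedOneForm k a x)) (q : ℍ[ℝ]) :=
    differentiableAt_ofSubsingleton
      (differentiableAt_of_contDiffOn_compl (contDiffOn_rotatedOneForm k a) hq).neg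
  have e : ∀ u : Tan q, (u : ℍ[ℝ]) = q * ((q : ℍ[ℝ])⁻¹ * u) := fun u => by
    rw [mul_inv_cancel_left₀ hq]
  -- Tangent vectors at `q` are exactly the `q p` with `p` imaginary, so all real parts drop out
  -- below.
  have hre : ∀ u : Tan q, ((q : ℍ[ℝ])⁻¹ * u).re = 0 := fun u => by
    have h1 := Submodule.mem_orthogonal_singleton_iff_inner_right.1 u.2
    rw [e u, inner_mul_right_self, q.norm_eq] at h1
    simpa using h1
  have key : ∀ u v : Tan q, HasDerivAt (fun t : ℝ => (ContinuousAlternatingMap.ofSubsingleton ℝ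
      ℍ[ℝ] ℝ (0 : Fin 1) (-rotatedOneForm k a ((q : ℍ[ℝ]) + t • (u : ℍ[ℝ])))) ![(v : ℍ[ℝ])]) _ 0 :=
    fun u v => by
      have := (hasDerivAt_rotatedOneForm_line k a hq ((q : ℍ[ℝ])⁻¹ * u) ((q : ℍ[ℝ])⁻¹ * v)).neg
      rw [← e u, ← e v] at this
      exact this
  rw [restrictSphere, form_two_comp_apply]
  simp only [Submodule.subtypeL_apply]
  rw [extDeriv_apply_two hd (key u v) (key v u), Pi.smul_apply,
    ContinuousAlternatingMap.smul_apply, conjTriple_apply]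
  simp only [eta_apply]
  have hu := hre u
  have hv := hre v
  generalize (q : ℍ[ℝ])⁻¹ * u = p at hu ⊢
  generalize (q : ℍ[ℝ])⁻¹ * v = w at hv ⊢
  have hk' : k 0 = -k 1 - k 2 := by linarith
  simp only [Fin.sum_univ_three, inner_imUnit, Quaternion.imI_sub, Quaternion.imJ_sub,
    Quaternion.imK_sub, Quaternion.imI_mul, Quaternion.imJ_mul, Quaternion.imK_mul, re_imUnit,
    imI_imUnit, imJ_imUnit, imK_imUnit, Fin.isValue, Fin.reduceAdd, zero_add, Matrix.cons_val,
    hu, hv, smul_eq_mul, hk']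
  ring

/-- The form is itself an eigenform with eigenvalue `-4`, so it serves as its own approximation. -/
theorem isNegativeFrequency_conjTriple {k : Fin 3 → ℝ} (hk : k 0 + k 1 + k 2 = 0) (a : Fin 3) :
    IsNegativeFrequency (conjTriple (leftInvariantTriple k) a) := by
  refine ⟨isSmoothForm_conjTriple k a, fun ε hε => ⟨conjTriple (leftInvariantTriple k) a,
    Submodule.subset_span ?_, fun q b => ?_⟩⟩
  · simp only [mem_iUnion]
    exact ⟨-4, by norm_num, isSmoothForm_conjTriple k a, dS_star2_conjTriple hk a⟩
  · simpa using hε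

theorem leftInvariantTriple_sub_stdTriple (k : Fin 3 → ℝ) :
    leftInvariantTriple k - stdTriple = leftInvariantTriple (k - 1) := by
  funext a q
  refine form_two_ext fun u v => ?_
  simp only [stdTriple, leftInvariantTriple, restrictSphere, Pi.sub_apply,
    ContinuousAlternatingMap.sub_apply, form_two_comp_apply, ContinuousAlternatingMap.smul_apply,
    smul_eq_mul, Pi.one_apply]
  ring

/-! ### A polynomial hyperkähler triple -/

/-- A family of polynomial triples: `q ω q⁻¹` with `ω₁ = -A ρ dρ ∧ η₁ + ρ² (A + B ρ²) η₂ ∧ η₃` and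
`ω_a = -(A + B ρ²) ρ dρ ∧ η_a + A ρ² η_b ∧ η_c` for `a = 2, 3`. -/
def polyTriple (A B : ℝ) (a : Fin 3) : TwoForm := fun x =>
  A • (wedge (innerSL ℝ 1) (innerSL ℝ (imUnit a))
      + wedge (innerSL ℝ (imUnit (a + 1))) (innerSL ℝ (imUnit (a + 2))))
    + B • (⟪imUnit a * x, x * imUnit 0⟫_ℝ •
        (wedge (innerSL ℝ (imUnit 1)) (innerSL ℝ (imUnit 2))
          - wedge (innerSL ℝ 1) (innerSL ℝ (imUnit 0)))
      + wedge (innerSL ℝ x) (innerSL ℝ (imUnit a * x)))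

theorem polyTriple_apply (A B : ℝ) (a : Fin 3) (x u v : ℍ[ℝ]) :
    polyTriple A B a x ![u, v] =
      A * (u.re * ⟪imUnit a, v⟫_ℝ - v.re * ⟪imUnit a, u⟫_ℝ
        + (⟪imUnit (a + 1), u⟫_ℝ * ⟪imUnit (a + 2), v⟫_ℝ
          - ⟪imUnit (a + 1), v⟫_ℝ * ⟪imUnit (a + 2), u⟫_ℝ))
      + B * (⟪imUnit a * x, x * imUnit 0⟫_ℝ *
          (u.imJ * v.imK - v.imJ * u.imK - (u.re * v.imI - v.re * u.imI))
        + (⟪x, u⟫_ℝ * ⟪imUnit a * x, v⟫_ℝ - ⟪x, v⟫_ℝ * ⟪imUnit a * x, u⟫_ℝ)) := by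
  have h1 : ∀ u : ℍ[ℝ], ⟪(1 : ℍ[ℝ]), u⟫_ℝ = u.re := fun u => by simp [inner_coord]
  simp only [polyTriple, ContinuousAlternatingMap.add_apply, ContinuousAlternatingMap.sub_apply,
    ContinuousAlternatingMap.smul_apply, wedge_apply, innerSL_apply_apply, smul_eq_mul, h1]
  simp only [inner_imUnit, Matrix.cons_val]

theorem contDiff_polyTriple (A B : ℝ) (a : Fin 3) : ContDiff ℝ ∞ (polyTriple A B a) := by
  have h1 : ContDiff ℝ ∞ (fun x : ℍ[ℝ] => ⟪imUnit a * x, x * imUnit 0⟫_ℝ) :=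
    (contDiff_const.mul contDiff_id).inner ℝ (contDiff_id.mul contDiff_const)
  have h2 : ContDiff ℝ ∞ (fun x : ℍ[ℝ] => innerSL ℝ x) := (innerSL ℝ).contDiff
  have h3 : ContDiff ℝ ∞ (fun x : ℍ[ℝ] => innerSL ℝ (imUnit a * x)) :=
    (innerSL ℝ).contDiff.comp (contDiff_const.mul contDiff_id)
  rw [← contDiffOn_univ] at *
  exact contDiffOn_const.add (contDiffOn_smul_of_real contDiffOn_const
    ((contDiffOn_smul_of_real h1 contDiffOn_const).add (contDiffOn_wedge h2 h3)))

theorem hasDerivAt_polyTriple_line (A B : ℝ) (a : Fin 3) (x u v w : ℍ[ℝ]) :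
    HasDerivAt (fun t : ℝ => polyTriple A B a (x + t • u) ![v, w])
      (B * ((⟪imUnit a * x, u * imUnit 0⟫_ℝ + ⟪imUnit a * u, x * imUnit 0⟫_ℝ) *
          (v.imJ * w.imK - w.imJ * v.imK - (v.re * w.imI - w.re * v.imI))
        + (⟪u, v⟫_ℝ * ⟪imUnit a * x, w⟫_ℝ + ⟪x, v⟫_ℝ * ⟪imUnit a * u, w⟫_ℝ
          - (⟪u, w⟫_ℝ * ⟪imUnit a * x, v⟫_ℝ + ⟪x, w⟫_ℝ * ⟪imUnit a * u, v⟫_ℝ)))) 0 := by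
  simp only [polyTriple_apply]
  have hl := hasDerivAt_line x u
  have hi : ∀ v : ℍ[ℝ], HasDerivAt (fun t : ℝ => ⟪x + t • u, v⟫_ℝ) ⟪u, v⟫_ℝ 0 := fun v => by
    simpa using hl.inner ℝ (hasDerivAt_const (0 : ℝ) v)
  have hj : ∀ v : ℍ[ℝ], HasDerivAt (fun t : ℝ => ⟪imUnit a * (x + t • u), v⟫_ℝ)
      ⟪imUnit a * u, v⟫_ℝ 0 := fun v => by
    simpa using (hl.const_mul (imUnit a)).inner ℝ (hasDerivAt_const (0 : ℝ) v)
  have hk := (hl.const_mul (imUnit a)).inner ℝ (hl.mul_const (imUnit 0))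
  have key := ((hk.mul_const
      (v.imJ * w.imK - w.imJ * v.imK - (v.re * w.imI - w.re * v.imI))).fun_add
    (((hi v).fun_mul (hj w)).fun_sub ((hi w).fun_mul (hj v)))).const_mul B
  refine (key.const_add _).congr_deriv ?_
  simp only [zero_smul, add_zero]

theorem extDeriv_polyTriple (A B : ℝ) (a : Fin 3) (x : ℍ[ℝ]) :
    extDeriv (polyTriple A B a) x = 0 := by
  have hd : DifferentiableAt ℝ (polyTriple A B a) x :=
    (contDiff_polyTriple A B a).contDiffAt.differentiableAt (by simp)
  ext w
  have e : w = ![w 0, w 1, w 2] := by funext i; fin_cases i <;> rfl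
  rw [e, extDeriv_apply_three hd (hasDerivAt_polyTriple_line A B a x _ _ _)
    (hasDerivAt_polyTriple_line A B a x _ _ _) (hasDerivAt_polyTriple_line A B a x _ _ _)]
  generalize w 0 = p
  generalize w 1 = q
  generalize w 2 = r
  simp only [inner_coord, Quaternion.re_mul, Quaternion.imI_mul, Quaternion.imJ_mul,
    Quaternion.imK_mul, re_imUnit, imI_imUnit, imJ_imUnit, imK_imUnit]
  fin_cases a <;> simp <;> ring

theorem wedgeTop_polyTriple (A B : ℝ) (x : ℍ[ℝ]) (a b : Fin 3) :
    wedgeTop (polyTriple A B a x) (polyTriple A B b x)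
      = if a = b then 2 * A * (A + B * ‖x‖ ^ 2) else 0 := by
  simp only [wedgeTop, polyTriple_apply, Fin.sum_univ_three, norm_sq_coord]
  simp only [inner_coord, Quaternion.re_mul, Quaternion.imI_mul, Quaternion.imJ_mul,
    Quaternion.imK_mul, re_imUnit, imI_imUnit, imJ_imUnit, imK_imUnit, Quaternion.re_one,
    Quaternion.imI_one, Quaternion.imJ_one, Quaternion.imK_one]
  fin_cases a <;> fin_cases b <;> simp <;> ring

theorem isHyperkahlerTriple_polyTriple {A B : ℝ} (hA : 0 < A) (hB : 0 ≤ B) {s : Set ℍ[ℝ]}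
    (hs : UniqueDiffOn ℝ s) : IsHyperkahlerTriple (polyTriple A B) s where
  smooth a := (contDiff_polyTriple A B a).contDiffOn
  closed a x hx := by
    have hd : DifferentiableAt ℝ (polyTriple A B a) x :=
      (contDiff_polyTriple A B a).contDiffAt.differentiableAt (by simp)
    -- Unique differentiability identifies the derivative within `s`, boundary points included, with
    -- the full derivative.
    rw [extDerivWithin, hd.fderivWithin (hs x hx)]
    exact extDeriv_polyTriple A B a x
  pos x _ := by
    simp only [wedgeTop_polyTriple, if_true, Fin.sum_univ_three]
    positivity
  orthogonal x _ a b := by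
    simp only [wedgeTop_polyTriple, if_true, Fin.sum_univ_three]
    split_ifs <;> ring

/-- Every radial coefficient carries a factor `‖x‖ ^ 2` on left-translated vectors. It cancels the
denominator of `rot`, leaving an identity between polynomials in the coordinates. -/
theorem polyTriple_eq_radialTriple (A B : ℝ) (a : Fin 3) {x : ℍ[ℝ]} (hx : x ≠ 0) :
    polyTriple A B a x = radialTriple
      (fun b ρ => -(![A, A + B * ρ ^ 2, A + B * ρ ^ 2] b))
      (fun b ρ => ρ ^ 2 * ![A + B * ρ ^ 2, A, A] b) a x := by
  have hn : ‖x‖ ^ 2 ≠ 0 := by positivity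
  refine form_ext_mul hx fun p => ?_
  have e : (fun i => x * p i) = ![x * p 0, x * p 1] := by funext i; fin_cases i <;> rfl
  rw [e, polyTriple_apply, radialTriple_apply_mul _ _ _ hx]
  generalize p 0 = u
  generalize p 1 = v
  have h : ∀ b (s t X Y : ℝ), rot x a b * (-s * ‖x‖ ^ 2 * X + ‖x‖ ^ 2 * t * Y)
      = rotPoly x a b * (-s * X + t * Y) := fun b s t X Y => by
    rw [rot_eq]
    field_simp
  simp only [h]
  simp only [Fin.sum_univ_three, rotPoly_eq_matrix, norm_sq_coord]
  simp only [inner_coord, Quaternion.re_mul, Quaternion.imI_mul, Quaternion.imJ_mul,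
    Quaternion.imK_mul, re_imUnit, imI_imUnit, imJ_imUnit, imK_imUnit]
  fin_cases a <;> simp <;> ring

theorem pullback_smul_polyTriple (A B l : ℝ) (a : Fin 3) :
    pullback (fun x => l • x) (polyTriple A B a) = polyTriple (A * l ^ 2) (B * l ^ 4) a := by
  funext x
  have hd : fderiv ℝ (fun x : ℍ[ℝ] => l • x) x = l • ContinuousLinearMap.id ℝ ℍ[ℝ] :=
    ((hasFDerivAt_id x).const_smul l).fderiv
  refine form_two_ext fun u v => ?_
  rw [pullback, form_two_comp_apply, hd, polyTriple_apply, polyTriple_apply]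
  simp only [smul_apply, ContinuousLinearMap.id_apply, inner_smul_left, inner_smul_right,
    mul_smul_comm, smul_mul_assoc, Quaternion.re_smul, Quaternion.imI_smul, Quaternion.imJ_smul,
    Quaternion.imK_smul, smul_eq_mul, conj_trivial]
  ring

theorem restrictSphere_polyTriple (A B : ℝ) (a : Fin 3) :
    restrictSphere (polyTriple A B a) = conjTriple (leftInvariantTriple ![A + B, A, A]) a := by
  funext q
  refine form_two_ext fun u v => ?_
  have h : ∀ u : Tan q, ⟪(q : ℍ[ℝ]), u⟫_ℝ = 0 := fun u =>
    Submodule.mem_orthogonal_singleton_iff_inner_right.1 u.2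
  rw [restrictSphere, form_two_comp_apply, polyTriple_eq_radialTriple A B a q.ne_zero,
    radialTriple_apply, conjTriple_apply]
  simp only [Submodule.subtypeL_apply, h, q.norm_eq]
  simp

/-! ### Taub–NUT -/

/-- With `w = √(2m + ρ²)` one has `N = -w`, `f₁ = 2mρ / w` and `f₂ = f₃ = ρ w`, so the roots
disappear from every product that enters the triple. -/
theorem tnProfile_mul_tnLapse {m ρ : ℝ} (hm : 0 < m) (hρ : 0 < ρ) (b : Fin 3) :
    tnProfile m b ρ * tnLapse m ρ
      = -(ρ * ![2 * m, 2 * m + ρ ^ 2, 2 * m + ρ ^ 2] b) := by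
  have h1 : 0 < 2 * m + ρ ^ 2 := by positivity
  have e1 : tnRadius m ρ - m = ρ ^ 2 := by rw [tnRadius]; ring
  have e2 : tnRadius m ρ + m = 2 * m + ρ ^ 2 := by rw [tnRadius]; ring
  have e3 : tnRadius m ρ ^ 2 - m ^ 2 = ρ ^ 2 * (2 * m + ρ ^ 2) := by rw [tnRadius]; ring
  have hs : √(2 * m + ρ ^ 2) ≠ 0 := by positivity
  have hs2 : √(2 * m + ρ ^ 2) ^ 2 = 2 * m + ρ ^ 2 := Real.sq_sqrt h1.le
  have hL : tnLapse m ρ = -√(2 * m + ρ ^ 2) := by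
    rw [tnLapse, e1, e2, Real.sqrt_div h1.le, Real.sqrt_sq hρ.le]
    field_simp
  have h0 : tnProfile m 0 ρ = 2 * m * (ρ / √(2 * m + ρ ^ 2)) := by
    simp only [tnProfile, Matrix.cons_val]
    rw [e1, e2, Real.sqrt_div (sq_nonneg ρ), Real.sqrt_sq hρ.le]
  have h2 : √(tnRadius m ρ ^ 2 - m ^ 2) = ρ * √(2 * m + ρ ^ 2) := by
    rw [e3, Real.sqrt_mul (sq_nonneg ρ), Real.sqrt_sq hρ.le]
  fin_cases b
  · simp only [Fin.zero_eta, h0, hL, Matrix.cons_val]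
    field_simp
  all_goals
    simp only [tnProfile, Matrix.cons_val, Fin.mk_one, Fin.reduceFinMk, h2, hL]
    linear_combination -ρ * hs2

theorem tnProfile_mul_tnProfile {m ρ : ℝ} (hm : 0 < m) (hρ : 0 < ρ) (b : Fin 3) :
    tnProfile m (b + 1) ρ * tnProfile m (b + 2) ρ
      = ρ ^ 2 * ![2 * m + ρ ^ 2, 2 * m, 2 * m] b := by
  have h1 : 0 < 2 * m + ρ ^ 2 := by positivity
  have e1 : tnRadius m ρ - m = ρ ^ 2 := by rw [tnRadius]; ring
  have e2 : tnRadius m ρ + m = 2 * m + ρ ^ 2 := by rw [tnRadius]; ring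
  have e3 : tnRadius m ρ ^ 2 - m ^ 2 = ρ ^ 2 * (2 * m + ρ ^ 2) := by rw [tnRadius]; ring
  have hs : √(2 * m + ρ ^ 2) ≠ 0 := by positivity
  have hs2 : √(2 * m + ρ ^ 2) ^ 2 = 2 * m + ρ ^ 2 := Real.sq_sqrt h1.le
  have h0 : tnProfile m 0 ρ = 2 * m * (ρ / √(2 * m + ρ ^ 2)) := by
    simp only [tnProfile, Matrix.cons_val]
    rw [e1, e2, Real.sqrt_div (sq_nonneg ρ), Real.sqrt_sq hρ.le]
  have h2 : √(tnRadius m ρ ^ 2 - m ^ 2) = ρ * √(2 * m + ρ ^ 2) := by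
    rw [e3, Real.sqrt_mul (sq_nonneg ρ), Real.sqrt_sq hρ.le]
  have h3 : tnProfile m 1 ρ = ρ * √(2 * m + ρ ^ 2) := h2
  have h4 : tnProfile m 2 ρ = ρ * √(2 * m + ρ ^ 2) := h2
  fin_cases b
  · simp only [Fin.zero_eta, Fin.isValue, zero_add, h3, h4, Matrix.cons_val]
    linear_combination ρ ^ 2 * hs2
  all_goals
    simp only [Fin.mk_one, Fin.reduceFinMk, Fin.isValue, Fin.reduceAdd, h0, h3, h4, Matrix.cons_val]
    field_simp

theorem polyTriple_eq_rotatingTriple {m : ℝ} (hm : 0 < m) (a : Fin 3) {x : ℍ[ℝ]} (hx : x ≠ 0) :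
    polyTriple (2 * m) 1 a x = rotatingTriple (tnLapse m) (tnProfile m) a x := by
  have hn : 0 < ‖x‖ := norm_pos_iff.2 hx
  rw [polyTriple_eq_radialTriple _ _ _ hx, rotatingTriple_eq_radialTriple]
  refine form_two_ext fun u v => ?_
  simp only [radialTriple_apply, tnProfile_mul_tnLapse hm hn, tnProfile_mul_tnProfile hm hn,
    one_mul, neg_div, mul_div_cancel_left₀ _ hn.ne']

/-- The covectors `N dρ` and `∑ b, rot x a b f_b η_b`. -/
def rotatedCoframe (N : ℝ) (f : Fin 3 → ℝ) (x : ℍ[ℝ]) : Fin 4 → ℍ[ℝ] →ₗ[ℝ] ℝ :=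
  Fin.cons (N • (innerSL ℝ (‖x‖⁻¹ • x) : ℍ[ℝ] →L[ℝ] ℝ).toLinearMap)
    (fun a => ∑ b, (rot x a b * f b) • (eta b x).toLinearMap)

theorem rotatedCoframe_zero (N : ℝ) (f : Fin 3 → ℝ) (x u : ℍ[ℝ]) :
    rotatedCoframe N f x 0 u = N * (‖x‖⁻¹ * ⟪x, u⟫_ℝ) := by
  simp [rotatedCoframe]

theorem rotatedCoframe_succ (N : ℝ) (f : Fin 3 → ℝ) (a : Fin 3) (x u : ℍ[ℝ]) :
    rotatedCoframe N f x a.succ u = ∑ b, rot x a b * (f b * eta b x u) := by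
  simp [rotatedCoframe, mul_assoc]

theorem sum_rotatedCoframe_mul (N : ℝ) (f : Fin 3 → ℝ) {x : ℍ[ℝ]} (hx : x ≠ 0) (u v : ℍ[ℝ]) :
    ∑ i, rotatedCoframe N f x i u * rotatedCoframe N f x i v =
      N * (‖x‖⁻¹ * ⟪x, u⟫_ℝ) * (N * (‖x‖⁻¹ * ⟪x, v⟫_ℝ))
        + ∑ b, f b * eta b x u * (f b * eta b x v) := by
  have h := fun b c => sum_rot_mul_rot_left hx b c
  simp only [Fin.sum_univ_succ (n := 3), rotatedCoframe_zero, rotatedCoframe_succ,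
    Fin.sum_univ_three] at h ⊢
  generalize f 0 * eta 0 x u = u0
  generalize f 1 * eta 1 x u = u1
  generalize f 2 * eta 2 x u = u2
  generalize f 0 * eta 0 x v = v0
  generalize f 1 * eta 1 x v = v1
  generalize f 2 * eta 2 x v = v2
  have h00 := h 0 0
  have h11 := h 1 1
  have h22 := h 2 2
  have h01 := h 0 1
  have h02 := h 0 2
  have h12 := h 1 2
  simp at h00 h11 h22 h01 h02 h12
  linear_combination u0 * v0 * h00 + u1 * v1 * h11 + u2 * v2 * h22 + (u0 * v1 + u1 * v0) * h01
    + (u0 * v2 + u2 * v0) * h02 + (u1 * v2 + u2 * v1) * h12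

/-- By `rot_cofactor`, rotating the triple amounts to rotating the coframe, which puts it in the
standard form `e⁰ ∧ e^a + e^b ∧ e^c`. -/
theorem rotatingTriple_eq_rotatedCoframe (N : ℝ → ℝ) (f : Fin 3 → ℝ → ℝ) (a : Fin 3) {x : ℍ[ℝ]}
    (hx : x ≠ 0) (u v : ℍ[ℝ]) :
    rotatingTriple N f a x ![u, v] =
      let e := rotatedCoframe (N ‖x‖) (fun b => f b ‖x‖) x
      (e 0 u * e a.succ v - e 0 v * e a.succ u)
        + (e (a + 1).succ u * e (a + 2).succ v - e (a + 1).succ v * e (a + 2).succ u) := by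
  have h := fun b => rot_cofactor hx a b
  have h0 := h 0
  have h1 := h 1
  have h2 := h 2
  simp only [Fin.isValue, Fin.reduceAdd, zero_add] at h0 h1 h2
  simp only [rotatingTriple_eq_radialTriple, radialTriple_apply, rotatedCoframe_zero,
    rotatedCoframe_succ, Fin.sum_univ_three, Fin.isValue, Fin.reduceAdd, zero_add]
  linear_combination
    -(f 1 ‖x‖ * f 2 ‖x‖ * (eta 1 x u * eta 2 x v - eta 1 x v * eta 2 x u)) * h0
    - (f 2 ‖x‖ * f 0 ‖x‖ * (eta 2 x u * eta 0 x v - eta 2 x v * eta 0 x u)) * h1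
    - (f 0 ‖x‖ * f 1 ‖x‖ * (eta 0 x u * eta 1 x v - eta 0 x v * eta 1 x u)) * h2

theorem inducesMetric_rotatingTriple (N : ℝ → ℝ) (f : Fin 3 → ℝ → ℝ) {x : ℍ[ℝ]} (hx : x ≠ 0)
    (hN : N ‖x‖ ≠ 0) (hf : ∀ b, f b ‖x‖ ≠ 0) :
    InducesMetric (fun a => rotatingTriple N f a x) (fun u v =>
      N ‖x‖ * (‖x‖⁻¹ * ⟪x, u⟫_ℝ) * (N ‖x‖ * (‖x‖⁻¹ * ⟪x, v⟫_ℝ))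
        + ∑ b, f b ‖x‖ * eta b x u * (f b ‖x‖ * eta b x v)) := by
  have hn : ‖x‖ ≠ 0 := by positivity
  set L : ℍ[ℝ] →ₗ[ℝ] (Fin 4 → ℝ) :=
    LinearMap.pi (rotatedCoframe (N ‖x‖) (fun b => f b ‖x‖) x) with hL
  -- The coframe is a basis because the sum of its squares is a positive definite form in the
  -- unrotated covectors.
  have hker : Function.Injective L := by
    rw [← LinearMap.ker_eq_bot, LinearMap.ker_eq_bot']
    intro u hu
    have hi : ∀ i, rotatedCoframe (N ‖x‖) (fun b => f b ‖x‖) x i u = 0 := fun i => congrFun hu i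
    have hs := sum_rotatedCoframe_mul (N ‖x‖) (fun b => f b ‖x‖) hx u u
    simp only [hi, ← sq] at hs
    have hp : 0 ≤ ∑ b, (f b ‖x‖ * eta b x u) ^ 2 := Finset.sum_nonneg fun b _ => sq_nonneg _
    have hp0 : (N ‖x‖ * (‖x‖⁻¹ * ⟪x, u⟫_ℝ)) ^ 2 = 0 := by
      nlinarith [sq_nonneg (N ‖x‖ * (‖x‖⁻¹ * ⟪x, u⟫_ℝ))]
    have hq0 : ∑ b, (f b ‖x‖ * eta b x u) ^ 2 = 0 := by linarith
    have hb : ∀ b, eta b x u = 0 := fun b => by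
      have := (Finset.sum_eq_zero_iff_of_nonneg fun b _ => sq_nonneg _).1 hq0 b (Finset.mem_univ b)
      simpa [hf b] using this
    have h0 : ⟪x, u⟫_ℝ = 0 := by simpa [hN, hn] using hp0
    obtain ⟨p, rfl⟩ : ∃ p, u = x * p := ⟨x⁻¹ * u, by rw [mul_inv_cancel_left₀ hx]⟩
    rw [inner_mul_right_self] at h0
    simp only [eta_apply_mul _ hx, inner_imUnit, neg_eq_zero] at hb
    have hp : p = 0 := by
      ext
      · simpa [hn] using h0
      · simpa using hb 0
      · simpa using hb 1
      · simpa using hb 2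
    rw [hp, mul_zero]
  let e := Module.Basis.ofEquivFun (LinearMap.linearEquivOfInjective L hker
    (by simp [Quaternion.finrank_eq_four]))
  have he : ∀ i u, e.coord i u = rotatedCoframe (N ‖x‖) (fun b => f b ‖x‖) x i u := fun i u => by
    simp [e, hL, Module.Basis.coord_apply]
  refine ⟨e, fun u v => ?_, fun a u v => ?_⟩
  · simp only [he]
    exact (sum_rotatedCoframe_mul _ _ hx u v).symm
  · simp only [he]
    exact rotatingTriple_eq_rotatedCoframe N f a hx u v

theorem isTaubNUT_polyTriple {m : ℝ} (hm : 0 < m) : IsTaubNUT m (polyTriple (2 * m) 1) where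
  hyperkahler := isHyperkahlerTriple_polyTriple (by positivity) zero_le_one uniqueDiffOn_univ
  eq_rotating a _ hx := polyTriple_eq_rotatingTriple hm a hx
  metric x hx := by
    have hn : 0 < ‖x‖ := norm_pos_iff.2 hx
    have h1 : 0 < 2 * m + ‖x‖ ^ 2 := by positivity
    have e1 : tnRadius m ‖x‖ - m = ‖x‖ ^ 2 := by rw [tnRadius]; ring
    have e2 : tnRadius m ‖x‖ + m = 2 * m + ‖x‖ ^ 2 := by rw [tnRadius]; ring
    have e3 : tnRadius m ‖x‖ ^ 2 - m ^ 2 = ‖x‖ ^ 2 * (2 * m + ‖x‖ ^ 2) := by rw [tnRadius]; ring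
    have hN : tnLapse m ‖x‖ ^ 2 = 2 * m + ‖x‖ ^ 2 := by
      rw [tnLapse, e1, e2, mul_pow, mul_pow, Real.sq_sqrt (by positivity)]
      field_simp
    have hf0 : tnProfile m 0 ‖x‖ ^ 2 = 4 * m ^ 2 * (‖x‖ ^ 2 / (2 * m + ‖x‖ ^ 2)) := by
      simp only [tnProfile, Matrix.cons_val]
      rw [e1, e2, mul_pow, Real.sq_sqrt (by positivity)]
      ring
    have hf1 : tnProfile m 1 ‖x‖ ^ 2 = ‖x‖ ^ 2 * (2 * m + ‖x‖ ^ 2) := by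
      simp only [tnProfile, Matrix.cons_val]
      rw [e3, Real.sq_sqrt (by positivity)]
    have hf2 : tnProfile m 2 ‖x‖ ^ 2 = ‖x‖ ^ 2 * (2 * m + ‖x‖ ^ 2) := hf1
    have hN0 : tnLapse m ‖x‖ ≠ 0 := fun h => by
      rw [h, zero_pow two_ne_zero] at hN
      exact h1.ne hN
    have hf : ∀ b, tnProfile m b ‖x‖ ≠ 0 := fun b h => by
      have h0 : tnProfile m b ‖x‖ ^ 2 ≠ 0 := by
        fin_cases b
        · simpa only [Fin.zero_eta, hf0] using by positivity
        · simpa only [Fin.mk_one, hf1] using by positivity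
        · simpa only [Fin.reduceFinMk, hf2] using by positivity
      exact h0 (by rw [h, zero_pow two_ne_zero])
    have key := inducesMetric_rotatingTriple (tnLapse m) (tnProfile m) hx hN0 hf
    have hg : tnMetric m x = fun u v =>
        tnLapse m ‖x‖ * (‖x‖⁻¹ * ⟪x, u⟫_ℝ) * (tnLapse m ‖x‖ * (‖x‖⁻¹ * ⟪x, v⟫_ℝ))
          + ∑ b, tnProfile m b ‖x‖ * eta b x u * (tnProfile m b ‖x‖ * eta b x v) := by
      funext u v
      simp only [Fin.sum_univ_three]
      calc tnMetric m x u v = (2 * m + ‖x‖ ^ 2) * (‖x‖ ^ 2)⁻¹ * (⟪x, u⟫_ℝ * ⟪x, v⟫_ℝ)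
            + 4 * m ^ 2 * (‖x‖ ^ 2 / (2 * m + ‖x‖ ^ 2)) * (eta 0 x u * eta 0 x v)
            + ‖x‖ ^ 2 * (2 * m + ‖x‖ ^ 2) * (eta 1 x u * eta 1 x v)
            + ‖x‖ ^ 2 * (2 * m + ‖x‖ ^ 2) * (eta 2 x u * eta 2 x v) := by
            simp only [tnMetric, e1, e2, e3]
            ring
        _ = _ := by
            rw [← hf0]
            -- `f₂²` and `f₃²` have the same value. Only its second occurrence, the coefficient of
            -- the third coframe element, is to become `f₃²`.
            nth_rewrite 2 [← hf2]
            rw [← hf1, ← hN]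
            ring
    rw [hg]
    simp only [polyTriple_eq_rotatingTriple hm _ hx]
    exact key

/-! ### The structure equations -/

/-- A backward Grönwall argument: if `|k| ≤ K` on `[ρ, 1]`, then `u² exp (2 K t)` is nondecreasing
there and vanishes at `1`. The bound is taken on `[ρ, 1]` because `k` may blow up at the origin. -/
theorem eq_zero_of_linear_ode {u k : ℝ → ℝ} (hk : ContinuousOn k (Ioc 0 1))
    (hu : ContinuousOn u (Ioc 0 1)) (hd : ∀ ρ ∈ Ioo (0 : ℝ) 1, HasDerivAt u (k ρ * u ρ) ρ)
    (h1 : u 1 = 0) {ρ : ℝ} (hρ : ρ ∈ Ioc (0 : ℝ) 1) : u ρ = 0 := by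
  have hsub : Icc ρ 1 ⊆ Ioc 0 1 := fun t ht => ⟨hρ.1.trans_le ht.1, ht.2⟩
  obtain ⟨K, hK⟩ := isCompact_Icc.exists_bound_of_continuousOn (hk.mono hsub)
  have hmono : MonotoneOn (fun t => u t ^ 2 * Real.exp (2 * K * t)) (Icc ρ 1) := by
    refine monotoneOn_of_hasDerivWithinAt_nonneg (f' := fun t =>
      2 * (k t + K) * (u t ^ 2 * Real.exp (2 * K * t))) (convex_Icc ρ 1)
      (((hu.mono hsub).pow 2).mul (by fun_prop)) (fun t ht => ?_) (fun t ht => ?_)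
    · rw [interior_Icc] at ht
      have hdt := hd t ⟨hρ.1.trans ht.1, ht.2⟩
      have he : HasDerivAt (fun t => Real.exp (2 * K * t)) (Real.exp (2 * K * t) * (2 * K)) t := by
        simpa using ((hasDerivAt_id t).const_mul (2 * K)).exp
      refine (((hdt.fun_pow 2).fun_mul he).congr_deriv ?_).hasDerivWithinAt
      push_cast
      ring
    · rw [interior_Icc] at ht
      have hb := neg_le_of_abs_le (hK t (Ioo_subset_Icc_self ht))
      have : 0 ≤ k t + K := by linarith
      positivity
  have h := hmono (left_mem_Icc.2 hρ.2) (right_mem_Icc.2 hρ.2) hρ.2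
  simp only [h1] at h
  have h2 : u ρ ^ 2 * Real.exp (2 * K * ρ) ≤ 0 := by simpa using h
  have h3 : u ρ ^ 2 ≤ 0 := nonpos_of_mul_nonpos_left h2 (Real.exp_pos _)
  exact pow_eq_zero_iff two_ne_zero |>.1 (le_antisymm h3 (sq_nonneg _))

theorem pos_of_ne_zero_of_pos_one {g : ℝ → ℝ} (hg : ContinuousOn g (Ioc 0 1))
    (h0 : ∀ ρ ∈ Ioc (0 : ℝ) 1, g ρ ≠ 0) (h1 : 0 < g 1) {ρ : ℝ} (hρ : ρ ∈ Ioc (0 : ℝ) 1) :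
    0 < g ρ := by
  by_contra! hneg
  have hsub : Icc ρ 1 ⊆ Ioc 0 1 := fun t ht => ⟨hρ.1.trans_le ht.1, ht.2⟩
  obtain ⟨t, ht, hz⟩ := intermediate_value_Icc hρ.2 (hg.mono hsub) ⟨hneg, h1.le⟩
  exact h0 t (hsub ht) hz

/-- The structure equations of a rotating invariant hyperkähler triple, in terms of
`g_a = f_b f_c` and `h_a = f_a N`, with Taub–NUT boundary values. -/
theorem structure_equations_unique {m L : ℝ} (hm : 0 < m) (hL : 0 < L) {g h : Fin 3 → ℝ → ℝ}
    (hg : ∀ b, ContinuousOn (g b) (Ioc 0 1)) (hh : ∀ b, ContinuousOn (h b) (Ioc 0 1))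
    (hgh : ∀ ρ ∈ Ioc (0 : ℝ) 1, ∀ b, h b ρ * g b ρ < 0)
    (heq : ∀ ρ b, h b ρ * g b ρ = h 0 ρ * g 0 ρ)
    (hd : ∀ ρ ∈ Ioo (0 : ℝ) 1, ∀ b,
      HasDerivAt (g b) (2 * (h b ρ - h (b + 1) ρ - h (b + 2) ρ)) ρ)
    (h1 : ∀ b, g b 1 = ![L * (L + 2 * m), 2 * m * L, 2 * m * L] b)
    {ρ : ℝ} (hρ : ρ ∈ Ioc (0 : ℝ) 1) :
    0 < g 1 ρ ∧ g 2 ρ = g 1 ρ ∧ g 0 ρ = g 1 ρ / (2 * m) * (g 1 ρ / (2 * m) + 2 * m) := by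
  have hne : ∀ b, ∀ ρ ∈ Ioc (0 : ℝ) 1, g b ρ ≠ 0 := fun b ρ hρ h0 => by
    simpa [h0] using hgh ρ hρ b
  have hpos : ∀ b, ∀ ρ ∈ Ioc (0 : ℝ) 1, 0 < g b ρ := fun b ρ hρ => by
    refine pos_of_ne_zero_of_pos_one (hg b) (hne b) ?_ hρ
    rw [h1]
    fin_cases b
    · simpa using by positivity
    · simpa using by positivity
    · simpa using by positivity
  -- The structure equations give `(g 1 - g 2)' = 4 (h 1 - h 2)`. Substituting `h 2 = h 1 * g 1 / g
  -- 2` makes this linear in `g 1 - g 2`.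
  have hu : ∀ ρ ∈ Ioc (0 : ℝ) 1, g 1 ρ - g 2 ρ = 0 := fun ρ hρ => by
    refine eq_zero_of_linear_ode (u := fun ρ => g 1 ρ - g 2 ρ) (k := fun ρ => -4 * h 1 ρ / g 2 ρ)
      ((continuousOn_const.mul (hh 1)).div (hg 2) (hne 2)) ((hg 1).sub (hg 2))
      (fun t ht => ?_) ?_ hρ
    · refine ((hd t ht 1).fun_sub (hd t ht 2)).congr_deriv ?_
      have h2 : h 2 t = h 1 t * g 1 t / g 2 t := by
        rw [eq_div_iff (hne 2 t (Ioo_subset_Ioc_self ht)), heq t 2, heq t 1]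
      have := hne 2 t (Ioo_subset_Ioc_self ht)
      simp only [Fin.isValue, Fin.reduceAdd, h2]
      field_simp
      ring
    · simp [h1]
  have hg2 : ∀ ρ ∈ Ioc (0 : ℝ) 1, g 2 ρ = g 1 ρ := fun ρ hρ => by linarith [hu ρ hρ]
  -- For Taub–NUT, `S = g 1 / (2m)` is the squared radius and `g 0 = S (S + 2m)`. The defect from
  -- this relation satisfies a linear ODE once `h 1 = h 2 = h 0 * g 0 / g 1` is inserted.
  have hz : g 0 ρ - (g 1 ρ / (2 * m)) * (g 1 ρ / (2 * m) + 2 * m) = 0 := by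
    refine eq_zero_of_linear_ode
      (u := fun ρ => g 0 ρ - (g 1 ρ / (2 * m)) * (g 1 ρ / (2 * m) + 2 * m))
      (k := fun ρ => -4 * h 0 ρ / g 1 ρ)
      ((continuousOn_const.mul (hh 0)).div (hg 1) (hne 1))
      ((hg 0).sub (((hg 1).div_const _).mul (((hg 1).div_const _).add continuousOn_const)))
      (fun t ht => ?_) ?_ hρ
    · have ht' := Ioo_subset_Ioc_self ht
      have hS := (hd t ht 1).div_const (2 * m)
      refine ((hd t ht 0).fun_sub (hS.fun_mul (hS.add_const (2 * m)))).congr_deriv ?_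
      have hn1 := hne 1 t ht'
      have e1 : h 1 t = h 0 t * g 0 t / g 1 t := by
        rw [eq_div_iff hn1, heq t 1]
      have e2 : h 2 t = h 0 t * g 0 t / g 1 t := by
        rw [eq_div_iff hn1, ← hg2 t ht', heq t 2]
      simp only [Fin.isValue, Fin.reduceAdd, zero_add, e1, e2]
      field_simp
      ring
    · simp only [h1, Matrix.cons_val]
      field_simp
      ring
  exact ⟨hpos 1 ρ hρ, hg2 ρ hρ, by linarith⟩

/-! ### Radial pull-backs -/

/-- In left-translated frames at `x` and its image, the differential fixes the imaginary part of `p`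
and scales the real part by the logarithmic derivative `ρ s' / s`. -/
theorem fderiv_radialMap_apply {s : ℝ → ℝ} {s' : ℝ} {x : ℍ[ℝ]} (hx : x ≠ 0)
    (hs : HasDerivAt s s' ‖x‖) (h0 : s ‖x‖ ≠ 0) (p : ℍ[ℝ]) :
    fderiv ℝ (radialMap s) x (x * p)
      = radialMap s x * (p + ((‖x‖ * s' / s ‖x‖ - 1) * p.re) • (1 : ℍ[ℝ])) := by
  have hn : ‖x‖ ≠ 0 := by positivity
  have hnd : DifferentiableAt ℝ (fun y : ℍ[ℝ] => ‖y‖) x := differentiableAt_id.norm ℝ hx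
  have hq : DifferentiableAt ℝ (fun y : ℍ[ℝ] => s ‖y‖ / ‖y‖) x := by
    simp only [div_eq_mul_inv]
    exact (hs.differentiableAt.comp x hnd).fun_mul (hnd.fun_inv hn)
  have hd : DifferentiableAt ℝ (radialMap s) x := hq.fun_smul differentiableAt_id
  have e0 : x + (0 : ℝ) • (x * p) = x := by simp
  have hd0 : HasFDerivAt (radialMap s) (fderiv ℝ (radialMap s) x) (x + (0 : ℝ) • (x * p)) := by
    rw [e0]
    exact hd.hasFDerivAt
  have hl := hasDerivAt_line x (x * p)
  have hnl := hasDerivAt_norm_line hx p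
  have hsl : HasDerivAt (fun t : ℝ => s ‖x + t • (x * p)‖) (s' * (‖x‖ * p.re)) 0 :=
    HasDerivAt.comp 0 (by rw [e0]; exact hs) hnl
  have h1 := hd0.comp_hasDerivAt 0 hl
  have h2 := (hsl.fun_div hnl (by rw [e0]; exact hn)).smul hl
  refine (h1.unique h2).trans ?_
  rw [e0, radialMap, smul_mul_assoc, mul_add, mul_smul_comm, mul_one, smul_add, smul_smul]
  congr 2
  field_simp

theorem pullback_radialMap {s : ℝ → ℝ} {s' : ℝ} {x : ℍ[ℝ]} (hx : x ≠ 0)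
    (hs : HasDerivAt s s' ‖x‖) (h0 : 0 < s ‖x‖) {τ : TwoForm} {H g : Fin 3 → ℝ → ℝ} {a : Fin 3}
    (hτ : ∀ y ≠ 0, τ y = radialTriple H g a y) :
    pullback (radialMap s) τ x =
      radialTriple (fun b ρ => H b (s ρ) * s ρ * s' / ρ) (fun b ρ => g b (s ρ)) a x := by
  have hn : 0 < ‖x‖ := norm_pos_iff.2 hx
  have hl : s ‖x‖ / ‖x‖ ≠ 0 := by positivity
  have hy : radialMap s x ≠ 0 := smul_ne_zero hl hx
  have hny : ‖radialMap s x‖ = s ‖x‖ := by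
    rw [radialMap, norm_smul, Real.norm_of_nonneg (by positivity), div_mul_cancel₀ _ hn.ne']
  have hr : ∀ b, rot (radialMap s x) a b = rot x a b := rot_smul hl x a
  refine form_ext_mul hx fun p => ?_
  have e : (fun i => x * p i) = ![x * p 0, x * p 1] := by funext i; fin_cases i <;> rfl
  rw [e, pullback, form_two_comp_apply, fderiv_radialMap_apply hx hs h0.ne',
    fderiv_radialMap_apply hx hs h0.ne', hτ _ hy, radialTriple_apply_mul _ _ _ hy,
    radialTriple_apply_mul _ _ _ hx]
  have hi : ∀ b (q : ℍ[ℝ]) (t : ℝ), ⟪imUnit b, q + t • (1 : ℍ[ℝ])⟫_ℝ = ⟪imUnit b, q⟫_ℝ :=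
    fun b q t => by
      rw [inner_imUnit, inner_imUnit]
      simp
  simp only [hr, hny, hi]
  refine Finset.sum_congr rfl fun b _ => ?_
  congr 2
  simp only [Quaternion.re_add, Quaternion.re_smul, Quaternion.re_one, smul_eq_mul]
  field_simp
  ring

/-! ### Rotating invariant fillings -/

theorem continuousOn_form_apply {X E : Type*} [TopologicalSpace X] [NormedAddCommGroup E]
    [NormedSpace ℝ E] {n : ℕ} {F : X → E [⋀^Fin n]→L[ℝ] ℝ} {t : Set X} (hF : ContinuousOn F t)
    (w : Fin n → E) : ContinuousOn (fun x => F x w) t :=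
  (ContinuousAlternatingMap.apply ℝ E ℝ w).continuous.comp_continuousOn hF

/-- On the positive real axis `rot` is the identity, so the coefficients can be read off component
by component. -/
theorem radialTriple_apply_real (H g : Fin 3 → ℝ → ℝ) (a : Fin 3) {ρ : ℝ} (hρ : 0 < ρ)
    (u v : ℍ[ℝ]) :
    radialTriple H g a (ρ • (1 : ℍ[ℝ])) ![u, v] =
      -(H a ρ * (u.re * ⟪imUnit a, v⟫_ℝ - v.re * ⟪imUnit a, u⟫_ℝ))
        + g a ρ / ρ ^ 2 * (⟪imUnit (a + 1), u⟫_ℝ * ⟪imUnit (a + 2), v⟫_ℝ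
          - ⟪imUnit (a + 1), v⟫_ℝ * ⟪imUnit (a + 2), u⟫_ℝ) := by
  have hn : ‖ρ • (1 : ℍ[ℝ])‖ = ρ := by rw [norm_smul, norm_one, mul_one, Real.norm_of_nonneg hρ.le]
  have hi : ∀ u : ℍ[ℝ], ⟪ρ • (1 : ℍ[ℝ]), u⟫_ℝ = ρ * u.re := fun u => by simp [inner_coord]
  have he : ∀ b (u : ℍ[ℝ]), eta b (ρ • (1 : ℍ[ℝ])) u = -(ρ⁻¹ * ⟪imUnit b, u⟫_ℝ) := fun b u => by
    rw [eta_apply, smul_inv₀, inv_one, smul_mul_assoc, one_mul, inner_smul_right]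
  simp only [radialTriple_apply, rot_smul hρ.ne', rot_one, hn, hi, he, ite_mul, one_mul, zero_mul,
    Finset.sum_ite_eq, Finset.mem_univ, if_true]
  field_simp
  ring

theorem wedgeTop_radialTriple_real (H g : Fin 3 → ℝ → ℝ) (a : Fin 3) {ρ : ℝ} (hρ : 0 < ρ) :
    wedgeTop (radialTriple H g a (ρ • (1 : ℍ[ℝ]))) (radialTriple H g a (ρ • (1 : ℍ[ℝ])))
      = -(2 * (H a ρ * g a ρ) / ρ ^ 2) := by
  simp only [wedgeTop, radialTriple_apply_real H g a hρ, Fin.sum_univ_three, inner_imUnit]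
  fin_cases a <;> simp <;> ring

/-- The closedness of a triple with smooth radial coefficients, as an equation for these. -/
theorem hasDerivAt_of_extDeriv_radialTriple {H g : Fin 3 → ℝ → ℝ} {ρ : ℝ} (hρ : 0 < ρ)
    (a : Fin 3) (hH : ∀ b, DifferentiableAt ℝ (H b) ρ) (hg : ∀ b, DifferentiableAt ℝ (g b) ρ)
    (hd : DifferentiableAt ℝ (radialTriple H g a) (ρ • (1 : ℍ[ℝ])))
    (h0 : extDeriv (radialTriple H g a) (ρ • (1 : ℍ[ℝ])) = 0) :
    HasDerivAt (g a) (2 * ρ * (H a ρ - H (a + 1) ρ - H (a + 2) ρ)) ρ := by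
  have hx : ρ • (1 : ℍ[ℝ]) ≠ 0 := smul_ne_zero hρ.ne' one_ne_zero
  have hn : ‖ρ • (1 : ℍ[ℝ])‖ = ρ := by rw [norm_smul, norm_one, mul_one, Real.norm_of_nonneg hρ.le]
  have key := extDeriv_radialTriple_apply a hx hd (H' := fun b => deriv (H b) ρ)
    (g' := fun b => deriv (g b) ρ) (fun b => by rw [hn]; exact (hH b).hasDerivAt)
    (fun b => by rw [hn]; exact (hg b).hasDerivAt) 1 (imUnit (a + 1)) (imUnit (a + 2))
  rw [h0] at key
  have h1 : ρ * (deriv (g a) ρ + 2 * ρ * (H (a + 1) ρ + H (a + 2) ρ - H a ρ)) = 0 := by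
    refine Eq.trans ?_ key.symm
    simp only [rot_smul hρ.ne', rot_one, hn, inner_imUnit, Fin.sum_univ_three]
    fin_cases a <;> simp <;> ring
  have h2 := (mul_eq_zero.1 h1).resolve_left hρ.ne'
  refine (hg a).hasDerivAt.congr_deriv ?_
  linear_combination h2

theorem exists_radialMap_of_isFilling {m L : ℝ} (hm : 0 < m) (hL : 0 < L) {τ' : Fin 3 → TwoForm}
    (hfill : IsFilling τ'
      (conjTriple (leftInvariantTriple ![L * (L + 2 * m), 2 * m * L, 2 * m * L])))
    (hinv : IsRotatingInvariant τ') :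
    ∃ s : ℝ → ℝ, ContinuousOn s (Icc 0 1) ∧ StrictMonoOn s (Icc 0 1) ∧
      ContDiffOn ℝ ∞ s (Ioc 0 1) ∧ s 0 = 0 ∧ s 1 = √L ∧
      ∀ a, ∀ x ∈ ball (0 : ℍ[ℝ]) 1, x ≠ 0 →
        τ' a x = pullback (radialMap s) (polyTriple (2 * m) 1 a) x := by
  obtain ⟨⟨hsm, hcl, hpos, -⟩, hbd⟩ := hfill
  obtain ⟨N, f, hN, hf, hτ⟩ := hinv
  simp only [rotatingTriple_eq_radialTriple] at hτ
  set h : Fin 3 → ℝ → ℝ := fun b ρ => f b ρ * N ρ with hdef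
  set g : Fin 3 → ℝ → ℝ := fun b ρ => f (b + 1) ρ * f (b + 2) ρ with gdef
  have hhs : ∀ b, ContDiffOn ℝ ∞ (h b) (Ioc 0 1) := fun b => (hf b).mul hN
  have hgs : ∀ b, ContDiffOn ℝ ∞ (g b) (Ioc 0 1) := fun b => (hf _).mul (hf _)
  set H : Fin 3 → ℝ → ℝ := fun b ρ => h b ρ / ρ with Hdef
  have hτ' : ∀ a, ∀ x ∈ closedBall (0 : ℍ[ℝ]) 1, x ≠ 0 → τ' a x = radialTriple H g a x := hτ
  have hnorm : ∀ {ρ : ℝ}, 0 < ρ → ‖ρ • (1 : ℍ[ℝ])‖ = ρ := fun hρ => by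
    rw [norm_smul, norm_one, mul_one, Real.norm_of_nonneg hρ.le]
  have hne : ∀ {ρ : ℝ}, 0 < ρ → ρ • (1 : ℍ[ℝ]) ≠ 0 := fun hρ => smul_ne_zero hρ.ne' one_ne_zero
  have hmem : ∀ {ρ : ℝ}, ρ ∈ Ioc (0 : ℝ) 1 → ρ • (1 : ℍ[ℝ]) ∈ closedBall (0 : ℍ[ℝ]) 1 :=
    fun hρ => by
      rw [mem_closedBall_zero_iff, hnorm hρ.1]
      exact hρ.2
  have heq : ∀ ρ b, h b ρ * g b ρ = h 0 ρ * g 0 ρ := fun ρ b => by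
    simp only [hdef, gdef]
    fin_cases b <;> simp <;> ring
  -- Positivity of the triple fixes the sign of the common product; it is negative because `η`
  -- carries a minus sign.
  have hgh : ∀ ρ ∈ Ioc (0 : ℝ) 1, ∀ b, h b ρ * g b ρ < 0 := fun ρ hρ b => by
    have hp := hpos _ (hmem hρ)
    have e : ∀ c, wedgeTop (τ' c (ρ • (1 : ℍ[ℝ]))) (τ' c (ρ • (1 : ℍ[ℝ])))
        = -(2 * (h 0 ρ * g 0 ρ) / ρ ^ 3) := fun c => by
      rw [hτ' c _ (hmem hρ) (hne hρ.1), wedgeTop_radialTriple_real _ _ _ hρ.1, ← heq ρ c]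
      have := hρ.1.ne'
      simp only [Hdef]
      field_simp
    simp only [e, Fin.sum_univ_three] at hp
    rw [heq]
    by_contra! hge
    have : 0 ≤ 2 * (h 0 ρ * g 0 ρ) / ρ ^ 3 := div_nonneg (by linarith) (pow_nonneg hρ.1.le 3)
    linarith
  have hda : ∀ {F : ℝ → ℝ}, ContDiffOn ℝ ∞ F (Ioc 0 1) → ∀ {ρ : ℝ}, ρ ∈ Ioo (0 : ℝ) 1 →
      DifferentiableAt ℝ F ρ := fun hF ρ hρ =>
    (hF.contDiffAt (Ioc_mem_nhds hρ.1 hρ.2)).differentiableAt (by simp)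
  have hd : ∀ ρ ∈ Ioo (0 : ℝ) 1, ∀ b,
      HasDerivAt (g b) (2 * (h b ρ - h (b + 1) ρ - h (b + 2) ρ)) ρ := fun ρ hρ b => by
    have hρ' := Ioo_subset_Ioc_self hρ
    have hnhds : closedBall (0 : ℍ[ℝ]) 1 ∈ nhds (ρ • (1 : ℍ[ℝ])) := by
      refine Filter.mem_of_superset (isOpen_ball.mem_nhds ?_) ball_subset_closedBall
      rw [mem_ball_zero_iff, hnorm hρ.1]
      exact hρ.2
    have hev : τ' b =ᶠ[nhds (ρ • (1 : ℍ[ℝ]))] radialTriple H g b := by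
      filter_upwards [hnhds, isOpen_compl_singleton.mem_nhds (hne hρ.1)] with x hx hx0
        using hτ' b x hx hx0
    have hdiff : DifferentiableAt ℝ (τ' b) (ρ • (1 : ℍ[ℝ])) :=
      ((hsm b).contDiffAt hnhds).differentiableAt (by simp)
    have hc := hcl b _ (hmem hρ')
    rw [extDerivWithin, fderivWithin_of_mem_nhds hnhds] at hc
    have key := hasDerivAt_of_extDeriv_radialTriple (H := H) hρ.1 b
      (fun c => (hda (hhs c) hρ).fun_div differentiableAt_id hρ.1.ne') (fun c => hda (hgs c) hρ)
      (hdiff.congr_of_eventuallyEq hev.symm) (by rw [← hev.extDeriv_eq]; exact hc)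
    refine key.congr_deriv ?_
    have := hρ.1.ne'
    simp only [Hdef]
    field_simp
  -- The boundary values are found by evaluating the filling condition at `q = 1` on the frame.
  have h1 : ∀ b, g b 1 = ![L * (L + 2 * m), 2 * m * L, 2 * m * L] b := fun b => by
    have e := congrArg (fun α => α (⟨1, by simp⟩ : S3)
      ![frame _ (b + 1), frame _ (b + 2)]) (hbd b)
    simp only [conjTriple_frame, rot_one, if_true, one_mul] at e
    rw [← e, restrictSphere, form_two_comp_apply]
    have e2 := hτ' b (1 : ℍ[ℝ]) (by simp) one_ne_zero
    have e3 := radialTriple_apply_real H g b zero_lt_one (imUnit (b + 1)) (imUnit (b + 2))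
    simp only [Submodule.subtypeL_apply, frame, one_mul]
    simp only [one_smul, inner_imUnit] at e3
    rw [e2, e3]
    fin_cases b <;> simp
  have hstr := fun ρ (hρ : ρ ∈ Ioc (0 : ℝ) 1) => structure_equations_unique hm hL
    (fun b => (hgs b).continuousOn) (fun b => (hhs b).continuousOn) hgh heq hd h1 hρ
  -- `G` extends `g 1` to `ρ = 0` with value `0`. It is continuous there because the filling is
  -- smooth at the origin, which yields continuity of `s` on `[0, 1]`.
  set G : ℝ → ℝ := fun ρ => ρ ^ 2 * τ' 1 (ρ • (1 : ℍ[ℝ])) ![imUnit 2, imUnit 0] with Gdef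
  have hG : ∀ ρ ∈ Ioc (0 : ℝ) 1, G ρ = g 1 ρ := fun ρ hρ => by
    have := hρ.1.ne'
    simp only [Gdef]
    rw [hτ' 1 _ (hmem hρ) (hne hρ.1), radialTriple_apply_real _ _ _ hρ.1]
    simp only [inner_imUnit]
    simp
    field_simp
  have hGc : ContinuousOn G (Icc 0 1) := by
    refine (continuousOn_id.pow 2).mul (continuousOn_form_apply ?_ _)
    refine (hsm 1).continuousOn.comp (by fun_prop) fun ρ hρ => ?_
    rw [mem_closedBall_zero_iff, norm_smul, norm_one, mul_one, Real.norm_of_nonneg hρ.1]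
    exact hρ.2
  have hs : ∀ ρ ∈ Ioc (0 : ℝ) 1, 0 < √(G ρ / (2 * m)) := fun ρ hρ => by
    have := (hstr ρ hρ).1
    rw [hG ρ hρ]
    positivity
  have hs2 : ∀ ρ ∈ Ioc (0 : ℝ) 1, g 1 ρ = 2 * m * √(G ρ / (2 * m)) ^ 2 := fun ρ hρ => by
    have := (hstr ρ hρ).1
    rw [hG ρ hρ, Real.sq_sqrt (by positivity)]
    field_simp
  -- As `h 1 = h 2`, the equation for `g 1 = 2 m s²` reads `g 1' = -2 h 0`. This gives `s'`, which
  -- is positive since `h 0 < 0`.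
  have hsd : ∀ ρ ∈ Ioo (0 : ℝ) 1, HasDerivAt (fun ρ => √(G ρ / (2 * m)))
      (-(h 0 ρ) / (2 * m * √(G ρ / (2 * m)))) ρ := fun ρ hρ => by
    have hρ' := Ioo_subset_Ioc_self hρ
    have hGd : HasDerivAt G (2 * (h 1 ρ - h 2 ρ - h 0 ρ)) ρ := by
      refine (hd ρ hρ 1).congr_of_eventuallyEq ?_
      filter_upwards [Ioc_mem_nhds hρ.1 hρ.2] with t ht using hG t ht
    have hh : h 2 ρ = h 1 ρ := by
      have e := (heq ρ 2).trans (heq ρ 1).symm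
      rw [(hstr ρ hρ').2.1] at e
      exact mul_right_cancel₀ (hstr ρ hρ').1.ne' e
    have hpos' : G ρ / (2 * m) ≠ 0 := (Real.sqrt_pos.1 (hs ρ hρ')).ne'
    refine ((hGd.div_const (2 * m)).sqrt hpos').congr_deriv ?_
    have := (hs ρ hρ').ne'
    rw [hh]
    field_simp
    ring
  refine ⟨fun ρ => √(G ρ / (2 * m)), (hGc.div_const _).sqrt, ?_, ?_, ?_, ?_, ?_⟩
  · refine strictMonoOn_of_deriv_pos (convex_Icc 0 1) (hGc.div_const _).sqrt fun ρ hρ => ?_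
    rw [interior_Icc] at hρ
    have hρ' := Ioo_subset_Ioc_self hρ
    rw [(hsd ρ hρ).deriv]
    have hg0 : 0 < g 0 ρ := by
      rw [(hstr ρ hρ').2.2]
      have := (hstr ρ hρ').1
      positivity
    have hh0 : h 0 ρ < 0 := by
      by_contra! hge
      exact absurd (hgh ρ hρ' 0) (not_lt.2 (mul_nonneg hge hg0.le))
    have := hs ρ hρ'
    exact div_pos (neg_pos.2 hh0) (by positivity)
  · have e : ContDiffOn ℝ ∞ (fun ρ => √(g 1 ρ / (2 * m))) (Ioc 0 1) :=
      ((hgs 1).div_const _).sqrt fun ρ hρ => (div_pos (hstr ρ hρ).1 (by positivity)).ne'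
    exact e.congr fun ρ hρ => by rw [hG ρ hρ]
  · simp [Gdef]
  · simp only [hG 1 (by simp), h1, Matrix.cons_val]
    congr 1
    field_simp
  · intro a x hx hx0
    rw [mem_ball_zero_iff] at hx
    have hn : 0 < ‖x‖ := norm_pos_iff.2 hx0
    have hρ : ‖x‖ ∈ Ioo (0 : ℝ) 1 := ⟨hn, hx⟩
    have hρ' := Ioo_subset_Ioc_self hρ
    rw [hτ' a x (mem_closedBall_zero_iff.2 hx.le) hx0,
      pullback_radialMap hx0 (hsd _ hρ) (hs _ hρ') fun y hy => polyTriple_eq_radialTriple _ _ a hy]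
    refine form_two_ext fun u v => ?_
    simp only [radialTriple_apply]
    have e1 := hs2 _ hρ'
    have hsp := hs _ hρ'
    obtain ⟨hp1, e2, e0⟩ := hstr _ hρ'
    generalize √(G ‖x‖ / (2 * m)) = s at e1 hsp ⊢
    have eg1 : g 1 ‖x‖ / (2 * m) = s ^ 2 := by
      rw [e1]
      field_simp
    rw [eg1] at e0
    -- All coefficients are now expressed through `s` and `h 0`, and then agree with those of the
    -- pulled-back Taub–NUT triple.
    have eh : ∀ b, g b ‖x‖ ≠ 0 → h b ‖x‖ = h 0 ‖x‖ * g 0 ‖x‖ / g b ‖x‖ := fun b hb => by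
      rw [eq_div_iff hb, heq]
    have eh1 := eh 1 hp1.ne'
    have eh2 := eh 2 (by rw [e2]; exact hp1.ne')
    rw [e2] at eh2
    rw [e0, e1] at eh1 eh2
    simp only [Fin.sum_univ_three, Hdef, e2, e0, e1, eh1, eh2, Matrix.cons_val]
    field_simp
    ring

end TaubNUTFilling

end

/-! ### Choice of the radius and proof of the proposition -/

open TaubNUTFilling
theorem mainTheorem12 :
    IsClosedFraming (conjTriple stdTriple) ∧ InducesRoundMetric (conjTriple stdTriple) ∧
    ∀ m : ℝ, 0 < m → ∃ τ : Fin 3 → TwoForm, IsTaubNUT m τ ∧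
      ∃ r₀ : ℝ, m < r₀ ∧ ∃ c : Fin 3 → ℝ,
        IsClosedFraming (conjTriple (leftInvariantTriple c)) ∧
        (∀ a, IsNegativeFrequency (conjTriple (leftInvariantTriple c - stdTriple) a)) ∧
        IsFilling (fun a => pullback (fun x => √(r₀ - m) • x) (τ a))
          (conjTriple (leftInvariantTriple c)) ∧
        ∀ τ' : Fin 3 → TwoForm, IsFilling τ' (conjTriple (leftInvariantTriple c)) →
          IsRotatingInvariant τ' →
          ∃ s : ℝ → ℝ, ContinuousOn s (Set.Icc 0 1) ∧ StrictMonoOn s (Set.Icc 0 1) ∧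
            ContDiffOn ℝ ∞ s (Set.Ioc 0 1) ∧ s 0 = 0 ∧ s 1 = √(r₀ - m) ∧
            ∀ a, ∀ x ∈ Metric.ball (0 : Quaternion ℝ) 1, x ≠ 0 →
              τ' a x = pullback (radialMap s) (τ a) x := by
  refine ⟨isClosedFraming_conjTriple fun _ => one_ne_zero, inducesRoundMetric_conjTriple_stdTriple,
    fun m hm => ⟨polyTriple (2 * m) 1, isTaubNUT_polyTriple hm, ?_⟩⟩
  -- The condition that the three constants sum to `3` is `L² + 6 m L = 3`, with positive root `√(9
  -- m² + 3) - 3 m`.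
  obtain ⟨L, hL, hL3⟩ : ∃ L : ℝ, 0 < L ∧ L * (L + 2 * m) + 2 * m * L + 2 * m * L = 3 := by
    have h := Real.sq_sqrt (show 0 ≤ 9 * m ^ 2 + 3 by positivity)
    refine ⟨√(9 * m ^ 2 + 3) - 3 * m, ?_, by linear_combination h⟩
    rw [sub_pos]
    exact Real.lt_sqrt_of_sq_lt (by nlinarith)
  refine ⟨m + L, by linarith, ![L * (L + 2 * m), 2 * m * L, 2 * m * L],
    isClosedFraming_conjTriple fun b => ?_, fun a => ?_, ⟨?_, fun a => ?_⟩, fun τ' hfill hinv => ?_⟩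
  · fin_cases b
    · simpa using ⟨hL.ne', by positivity⟩
    all_goals simpa using ⟨hm.ne', hL.ne'⟩
  · rw [leftInvariantTriple_sub_stdTriple]
    refine isNegativeFrequency_conjTriple ?_ a
    simp only [Pi.sub_apply, Pi.one_apply, Matrix.cons_val]
    linarith
  -- Dilation by `√L` stays in the polynomial family, sending `(A, B) = (2m, 1)` to `(2mL, L²)`.
  · have e : (fun a => pullback (fun x => √(m + L - m) • x) (polyTriple (2 * m) 1 a))
        = polyTriple (2 * m * √(m + L - m) ^ 2) (1 * √(m + L - m) ^ 4) := by
      funext a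
      exact pullback_smul_polyTriple _ _ _ a
    rw [e, add_sub_cancel_left]
    refine isHyperkahlerTriple_polyTriple (by positivity) (by positivity)
      (uniqueDiffOn_convex (convex_closedBall 0 1) ?_)
    exact ⟨0, ball_subset_interior_closedBall (by simp)⟩
  · beta_reduce
    rw [pullback_smul_polyTriple, restrictSphere_polyTriple, add_sub_cancel_left,
      show √L ^ 4 = (√L ^ 2) ^ 2 by ring, Real.sq_sqrt hL.le,
      show 2 * m * L + 1 * L ^ 2 = L * (L + 2 * m) by ring]
  · rw [add_sub_cancel_left]
    exact exists_radialMap_of_isFilling hm hL hfill hinv
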